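/- Let $d=2$. A bipartite pure state $\sum_{\mu\nu}\Psi_{\mu\nu}|\mu\nu\rangle$ of arbitrary finite local dimensions is identified with the matrix $\Psi$ ($\|\Psi\|_2=1$); its Schmidt numbers are the squared singular values $\sigma^2(\Psi)$. A series-parallel quantum network between $A$ and $B$ is either a single link, in the state $\mathrm{diag}(\boldsymbol\lambda)^{1/2}$ with $\boldsymbol\lambda=(\lambda_1,\lambda_2)$, $\lambda_j\ge 0$, $\lambda_1+\lambda_2=1$, or a series connection (through relay nodes) or a parallel connection (with common end nodes) of finitely many series-parallel networks. *Series and parallel rules.* To each series-parallel network assign a vector of $d$ Schmidt numbers: to a link its $\boldsymbol\lambda$; to a series connection of networks with vectors $\mathbf x_0,\dots,\mathbf x_n$ the vector $\mathcal S(\cdots\mathcal S(\mathcal S(\mathbf x_0,\mathbf x_1),\mathbf x_2)\cdots,\mathbf x_n)$, where $\mathcal S(\mathbf x,\mathbf y)=d\,\sigma^2\big(\mathrm{diag}(\mathbf x^{\downarrow})^{1/2}\,V\,\mathrm{diag}(\mathbf y^{\downarrow})^{1/2}\big)$ in decreasing order and $V_{\mu\nu}=d^{-1/2}e^{-2\pi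 i\mu\nu/d}$ ($\mu,\nu=1,\dots,d$); to a parallel connection the vector $\mathcal P(\mathbf x_0\otimes\cdots\otimes\mathbf x_n)$, where $\mathcal P(\mathbf x)=(\chi_1,\dots,\chi_d)$ is computed by starting with $s=\sum_j x_j$ and, for $l=1,\dots,d$, setting $\chi_l=\max\{x^{\downarrow}_l,\,s/(d+1-l)\}$ and then replacing $s$ by $s-\chi_l$. Here $\mathbf x^{\downarrow}$ is the decreasing rearrangement of $\mathbf x$. *Generic protocols.* A scheme is a finite adaptive sequence (every operation may depend on all previous outcomes) of the following operations, which ends with a single two-qubit link between $A$ and $B$: (i) purification: on a link in state $\Psi$ one of its two end nodes performs a measurement with Kraus operators $M_\alpha$, $\sum_\alpha M_\alpha^\dagger M_\alpha=1$ (the local dimension may change); outcome $\alpha$ has probability $p_\alpha=\|\Psi^\alpha\|_2^2$ and post-measurement state $\Psi^\alpha/\|\Psi^\alpha\|_2$, where $\Psi^\alpha=M_\alpha\Psi$ or $\Psi^\alpha=\Psi M_\alpha^{T}$ according to the end node that measures; (ii) two links in parallel, in states $\Psi,\Phi$, are treated as one link in state $\Psi\otimes\Phi$; (iii) entanglement swapping: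 two links in series, in states $\Psi,\Phi$, are replaced, by a measurement on the relay, with one link in state $\Psi^\alpha/\|\Psi^\alpha\|_2$, $\Psi^\alpha=\Psi X^\alpha\Phi$, with probability $p_\alpha=\|\Psi^\alpha\|_2^2$, where $\sum_\alpha \overline{X^\alpha_{\mu\nu}}X^\alpha_{\mu'\nu'}=\delta_{\mu\mu'}\delta_{\nu\nu'}$. All measurements have finitely many outcomes. The operations may be applied at any place of the network and in any order; the grouping of links connected in series, and the grouping and order of links connected in parallel, do not matter. The worst-case $G$-concurrence of a scheme is the minimum, over the final states $\Psi$ reached with positive probability, of $C_d(\sigma^2(\Psi))$, where $C_d(\boldsymbol\lambda)=d(\lambda_1\cdots\lambda_d)^{1/d}$, that is, $C_2(\boldsymbol\lambda)=2\sqrt{\lambda_1\lambda_2}$. **Theorem.** Let a series-parallel network of qubit links ($d=2$) be given, and let $\boldsymbol\lambda$ be the vector which the series and parallel rules assign to it. There is a scheme all of whose final states reached with positive probability have the Schmidt numbers $\boldsymbol\lambda$ (up to order), and $C_2(\boldsymbol\lambda)$ is the maximum of the worst-case $G$-concurrence over all schemes. -/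

import Mathlib

open scoped Matrix

namespace DET

noncomputable section

/-! ### Vectors of Schmidt numbers, concurrences -/

/-- The entries of `x` in decreasing order (with multiplicity); entry `0` is the largest one, and the
list is continued by zeros. -/
def sorted {ι : Type*} [Fintype ι] (x : ι → ℝ) (l : ℕ) : ℝ :=
  ((Finset.univ.val.map x).sort (· ≥ ·)).getD l 0

/-- The decreasing rearrangement of a vector of length `d`. -/
def desc {d : ℕ} (x : Fin d → ℝ) : Fin d → ℝ := fun i => sorted x i

/-- `k`-th elementary symmetric polynomial of the entries of `x`. -/
def elemSymm {d : ℕ} (k : ℕ) (x : Fin d → ℝ) : ℝ := (Finset.univ.val.map x).esymm k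

/-- The `k`-concurrence `C_k(x) = (S_k(x) / S_k(1/d, …, 1/d)) ^ (1/k)`. -/
def kConcurrence {d : ℕ} (k : ℕ) (x : Fin d → ℝ) : ℝ :=
  (elemSymm k x / elemSymm k (fun _ : Fin d => (1 : ℝ) / d)) ^ ((1 : ℝ) / k)

/-- The `G`-concurrence `C_d`. -/
def gConcurrence {d : ℕ} (x : Fin d → ℝ) : ℝ := kConcurrence d x

/-- The squares of the singular values of a `d × d` matrix, in decreasing order. For a normalized
matricized state these are its Schmidt numbers. -/
def sqSingularValues {d : ℕ} (A : Matrix (Fin d) (Fin d) ℂ) : Fin d → ℝ :=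
  fun i => (Matrix.toEuclideanLin A).singularValues i ^ 2

/-! ### The series rule and the parallel rule -/

/-- The unitary `V_{μν} = d^{-1/2} exp(-2πi μν/d)`, `μ, ν = 1, …, d`. -/
def fourier (d : ℕ) : Matrix (Fin d) (Fin d) ℂ := fun μ ν =>
  ((Real.sqrt d : ℝ) : ℂ)⁻¹ *
    Complex.exp (-2 * Real.pi * Complex.I * ((μ : ℂ) + 1) * ((ν : ℂ) + 1) / d)

/-- The diagonal matrix `diag(x)^{1/2}`. -/
def sqrtDiag {d : ℕ} (x : Fin d → ℝ) : Matrix (Fin d) (Fin d) ℂ :=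
  Matrix.diagonal fun i => ((Real.sqrt (x i) : ℝ) : ℂ)

/-- The swapping function `S(x, y) = d σ²(diag(x↓)^{1/2} V diag(y↓)^{1/2})`. -/
def swapFun {d : ℕ} (x y : Fin d → ℝ) : Fin d → ℝ := fun i =>
  d * sqSingularValues (sqrtDiag (desc x) * fourier d * sqrtDiag (desc y)) i

/-- The variable `s` of the purification loop before the pass with (zero-based) index `l`. -/
def purifyRest {ι : Type*} [Fintype ι] (d : ℕ) (x : ι → ℝ) : ℕ → ℝ
  | 0 => ∑ j, x j
  | l + 1 => purifyRest d x l - max (sorted x l) (purifyRest d x l / ((d : ℝ) - l))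

/-- The purification function `P`: with `s = ∑ x_j` at the start, for `l = 1, …, d` put
`χ_l = max {x↓_l, s / (d + 1 - l)}` and replace `s` by `s - χ_l`. Here `l` is counted from `0`. -/
def purifyFun {ι : Type*} [Fintype ι] (d : ℕ) (x : ι → ℝ) : Fin d → ℝ := fun l =>
  max (sorted x l) (purifyRest d x l / ((d : ℝ) - l))

/-! ### Series-parallel networks -/

/-- The left-grouped combination `x₀ ∘ x₁ ∘ ⋯ ∘ xₙ` by a binary operation. -/
def foldLeft {X : Type*} (op : X → X → X) : (n : ℕ) → (Fin (n + 1) → X) → X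
  | 0, f => f 0
  | n + 1, f => op (foldLeft op n fun i => f i.castSucc) (f (Fin.last (n + 1)))

/-- A two-terminal series-parallel network between `A` and `B`: a single link in the pure state with
Schmidt numbers `x`, or a series connection (glued at relay nodes, in the given order from `A` to
`B`), or a parallel connection (with common end points) of `n + 1` such networks. -/
inductive SPNetwork (d : ℕ) : Type
  | link (x : stdSimplex ℝ (Fin d)) : SPNetwork d
  | series (n : ℕ) (N : Fin (n + 1) → SPNetwork d) : SPNetwork d
  | parallel (n : ℕ) (N : Fin (n + 1) → SPNetwork d) : SPNetwork d

/-- The Schmidt numbers which the series and parallel rules assign to a network. The entries of the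
Kronecker product `x₀ ⊗ ⋯ ⊗ xₙ` are indexed by `Fin (n + 1) → Fin d`. -/
def SPNetwork.rule {d : ℕ} : SPNetwork d → Fin d → ℝ
  | .link x => x
  | .series n N => foldLeft swapFun n fun i => (N i).rule
  | .parallel n N => purifyFun d fun f : Fin (n + 1) → Fin d => ∏ i, (N i).rule (f i)

/-! ### Quantum states of a network, local protocols -/

/-- The current state of a network, while a scheme is being carried out. A link joining a node `u`
(on the side of `A`) to a node `v` (on the side of `B`) is in a bipartite pure state
`∑ Ψ_{μν} |μ⟩_u |ν⟩_v`, given by its matrix `Ψ`; the local dimensions are arbitrary. -/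
inductive NetState : Type
  | link {m n : ℕ} (Ψ : Matrix (Fin m) (Fin n) ℂ) : NetState
  | series (N₁ N₂ : NetState) : NetState
  | parallel (N₁ N₂ : NetState) : NetState

/-- The initial state: every link is in the state `∑ √(x_j) |jj⟩`. -/
def SPNetwork.state {d : ℕ} : SPNetwork d → NetState
  | .link x => .link (sqrtDiag (x : Fin d → ℝ))
  | .series n N => foldLeft .series n fun i => (N i).state
  | .parallel n N => foldLeft .parallel n fun i => (N i).state

/-- Two expressions for one and the same network: series connection is associative, parallel
connection is associative and commutative. -/
inductive NetState.Same : NetState → NetState → Prop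
  | refl (N) : Same N N
  | symm {N N'} : Same N N' → Same N' N
  | trans {N N' N''} : Same N N' → Same N' N'' → Same N N''
  | series_assoc (N₁ N₂ N₃) : Same (.series (.series N₁ N₂) N₃) (.series N₁ (.series N₂ N₃))
  | parallel_assoc (N₁ N₂ N₃) :
      Same (.parallel (.parallel N₁ N₂) N₃) (.parallel N₁ (.parallel N₂ N₃))
  | parallel_comm (N₁ N₂) : Same (.parallel N₁ N₂) (.parallel N₂ N₁)
  | series {N₁ N₁' N₂ N₂'} : Same N₁ N₁' → Same N₂ N₂' → Same (.series N₁ N₂) (.series N₁' N₂')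
  | parallel {N₁ N₁' N₂ N₂'} :
      Same N₁ N₁' → Same N₂ N₂' → Same (.parallel N₁ N₂) (.parallel N₁' N₂')

/-- `‖Ψ‖₂²`, the probability of an outcome with unnormalized state `Ψ`. -/
def prob {m n : ℕ} (Ψ : Matrix (Fin m) (Fin n) ℂ) : ℝ := ∑ i, ∑ j, ‖Ψ i j‖ ^ 2

/-- The normalized state `Ψ / ‖Ψ‖₂`. -/
def normalized {m n : ℕ} (Ψ : Matrix (Fin m) (Fin n) ℂ) : Matrix (Fin m) (Fin n) ℂ :=
  ((Real.sqrt (prob Ψ) : ℝ) : ℂ)⁻¹ • Ψ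

/-- The joint state of two links with the same end points: the Kronecker product. -/
def tensor {m n m' n' : ℕ} (Ψ : Matrix (Fin m) (Fin n) ℂ) (Φ : Matrix (Fin m') (Fin n') ℂ) :
    Matrix (Fin (m * m')) (Fin (n * n')) ℂ :=
  (Matrix.kroneckerMap (· * ·) Ψ Φ).reindex finProdFinEquiv finProdFinEquiv

/-- Completeness `∑_α M_α† M_α = 1` of the Kraus operators of a local measurement, which may change
the local dimension. -/
def IsLocalMeasurement {k m : ℕ} {r : Fin k → ℕ} (M : ∀ α, Matrix (Fin (r α)) (Fin m) ℂ) : Prop :=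
  ∑ α, (M α)ᴴ * M α = 1

/-- Completeness `∑_α conj(X^α_{μν}) X^α_{μ'ν'} = δ_{μμ'} δ_{νν'}` of a measurement on a relay. -/
def IsSwapMeasurement {k m n : ℕ} (X : Fin k → Matrix (Fin m) (Fin n) ℂ) : Prop :=
  ∀ μ μ' ν ν', ∑ α, star (X α μ ν) * X α μ' ν' = if μ = μ' ∧ ν = ν' then 1 else 0

/-- `Step N k p N'`: an elementary operation on the network state `N`, whose outcome `α : Fin k` has
probability `p α` and leads to the network state `N' α`.
* `measureLeft`, `measureRight`: one of the two parties sharing a link performs a local measurement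
  (sequences of these are the LOCC protocols on a link, i.e. the purification protocols);
* `merge`: links in parallel are regarded as a single link of larger dimension;
* `swap`: an entanglement swapping protocol on two links in series;
* `same`: rewriting the expression of the network;
* the remaining ones: operating inside a larger network. -/
inductive Step : NetState → (k : ℕ) → (Fin k → ℝ) → (Fin k → NetState) → Prop
  | measureLeft {m n k : ℕ} {r : Fin k → ℕ} (Ψ : Matrix (Fin m) (Fin n) ℂ)
      (M : ∀ α, Matrix (Fin (r α)) (Fin m) ℂ) (hM : IsLocalMeasurement M) :
      Step (.link Ψ) k (fun α => prob (M α * Ψ)) (fun α => .link (normalized (M α * Ψ)))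
  | measureRight {m n k : ℕ} {r : Fin k → ℕ} (Ψ : Matrix (Fin m) (Fin n) ℂ)
      (M : ∀ α, Matrix (Fin (r α)) (Fin n) ℂ) (hM : IsLocalMeasurement M) :
      Step (.link Ψ) k (fun α => prob (Ψ * (M α)ᵀ)) (fun α => .link (normalized (Ψ * (M α)ᵀ)))
  | merge {m n m' n' : ℕ} (Ψ : Matrix (Fin m) (Fin n) ℂ) (Φ : Matrix (Fin m') (Fin n') ℂ) :
      Step (.parallel (.link Ψ) (.link Φ)) 1 (fun _ => 1) (fun _ => .link (tensor Ψ Φ))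
  | swap {m n m' n' k : ℕ} (Ψ : Matrix (Fin m) (Fin n) ℂ) (Φ : Matrix (Fin m') (Fin n') ℂ)
      (X : Fin k → Matrix (Fin n) (Fin m') ℂ) (hX : IsSwapMeasurement X) :
      Step (.series (.link Ψ) (.link Φ)) k (fun α => prob (Ψ * X α * Φ))
        (fun α => .link (normalized (Ψ * X α * Φ)))
  | same {N N' : NetState} (h : N.Same N') : Step N 1 (fun _ => 1) (fun _ => N')
  | seriesLeft {N k p N'} (L : NetState) (h : Step N k p N') :
      Step (.series N L) k p (fun α => .series (N' α) L)
  | seriesRight {N k p N'} (L : NetState) (h : Step N k p N') :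
      Step (.series L N) k p (fun α => .series L (N' α))
  | parallelLeft {N k p N'} (L : NetState) (h : Step N k p N') :
      Step (.parallel N L) k p (fun α => .parallel (N' α) L)
  | parallelRight {N k p N'} (L : NetState) (h : Step N k p N') :
      Step (.parallel L N) k p (fun α => .parallel L (N' α))

/-- An adaptive scheme which turns the network state `N` into a link between `A` and `B` of local
dimensions `d × d`: every operation may depend on all the outcomes obtained before. -/
inductive Scheme (d : ℕ) : NetState → Type
  | done (Ψ : Matrix (Fin d) (Fin d) ℂ) : Scheme d (.link Ψ)
  | step {N : NetState} {k : ℕ} {p : Fin k → ℝ} {N' : Fin k → NetState} (h : Step N k p N')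
      (next : ∀ α, 0 < p α → Scheme d (N' α)) : Scheme d N

/-- The final states between `A` and `B` that a scheme produces with positive probability. -/
def Scheme.outcomes {d : ℕ} : {N : NetState} → Scheme d N → Set (Matrix (Fin d) (Fin d) ℂ)
  | _, .done Ψ => {Ψ}
  | _, .step (p := p) _ next => ⋃ (α) (h : 0 < p α), (next α h).outcomes

/-- The worst-case `G`-concurrence of a scheme: the minimum over its (finitely many) outcomes. -/
def Scheme.worstCase {d : ℕ} {N : NetState} (s : Scheme d N) : ℝ :=
  sInf ((fun Ψ => gConcurrence (sqSingularValues Ψ)) '' s.outcomes)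

end

end DET

open scoped Matrix

namespace DET

noncomputable section


/-! Each network state gets a number `NetState.value` in `[1/2, 1]`: the larger Schmidt number of
the best two-qubit link obtainable with certainty. A link has `max (1/2) (top Ψ)`, with `top` the
largest squared singular value. A series connection multiplies the concurrences `2√(μ(1-μ))`, and a
parallel connection gives `max (1/2) (a * b)`. The rules compute this number for the initial state
(`SPNetwork.valid_and_rule`), and regrouping does not change it.

Optimality: every operation has an outcome of positive probability for which the value does not
decrease (`Step.exists_value_le`). Following such outcomes through a scheme leads to a final state
at least as bad as the rules predict. For local measurements this holds because the average of `top`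
does not decrease; for merging, because `top` is at least multiplicative on tensor products.

Swapping is the hard case, since the links may have any dimension and determinants are not
available. In place of multiplicativity of the determinant there is a variational bound. Let `S²`
have eigenvalue `α` on a unit vector `e` and `A = 1/α` on its complement, and let `T²` be defined
likewise by `f`, `β`, `B`. Then `‖S Y T‖²` (`weight`) dominates the concurrence of the best
two-level state obtainable from `Y` (`concurrence_le_weight`). For 2 × 2 matrices this is `‖S Y T‖²
≥ 2|det (S Y T)| = 2|det Y|`. The weight is quadratic in `Y`, so its sum over the outcomes `Y = Ψ X
Φ` is exactly `‖S Ψ‖² ‖Φ T‖²`. With `e` and `f` leading singular vectors and `A`, `B` optimized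
(`exists_tilt`), this is the product of the two concurrences, up to an arbitrarily small error.

Attainability: swapping with a maximally entangled basis unbiased to the Schmidt bases gives the
same Schmidt numbers for all outcomes. Two parallel qubit links have Schmidt numbers `ab, a(1-b),
(1-a)b, (1-a)(1-b)`, and the last three levels can be merged with certainty when `ab ≥ 1/2`.
Otherwise one link is first degraded until the product is `1/2`. -/

/-! ### Norms of vectors and matrices -/

/-- The squared Euclidean norm of a complex vector. -/
def nsq {n : ℕ} (v : Fin n → ℂ) : ℝ := ∑ i, ‖v i‖ ^ 2

lemma nsq_nonneg {n : ℕ} (v : Fin n → ℂ) : 0 ≤ nsq v := by unfold nsq; positivity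

lemma nsq_smul {n : ℕ} (c : ℂ) (v : Fin n → ℂ) : nsq (c • v) = ‖c‖ ^ 2 * nsq v := by
  simp [nsq, Finset.mul_sum, mul_pow]

lemma nsq_star {n : ℕ} (v : Fin n → ℂ) : nsq (star v) = nsq v := by simp [nsq]

lemma nsq_eq_zero {n : ℕ} {v : Fin n → ℂ} : nsq v = 0 ↔ v = 0 := by
  unfold nsq
  rw [Finset.sum_eq_zero_iff_of_nonneg (fun i _ => by positivity)]
  simp [funext_iff]

lemma star_dotProduct_self {n : ℕ} (v : Fin n → ℂ) : star v ⬝ᵥ v = (nsq v : ℂ) := by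
  simp [nsq, dotProduct, Complex.conj_mul']

lemma nsq_add {n : ℕ} (u v : Fin n → ℂ) :
    nsq (u + v) = nsq u + nsq v + 2 * (star u ⬝ᵥ v).re := by
  simp only [nsq, dotProduct, Complex.re_sum, Finset.mul_sum, ← Finset.sum_add_distrib]
  refine Finset.sum_congr rfl fun i _ => ?_
  simp only [Complex.sq_norm, Complex.normSq_apply, Pi.add_apply, Pi.star_apply, Complex.add_re,
    Complex.add_im, Complex.mul_re, Complex.star_def, Complex.conj_re, Complex.conj_im]
  ring

lemma nsq_add_of_orthogonal {n : ℕ} {u v : Fin n → ℂ} (h : star u ⬝ᵥ v = 0) :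
    nsq (u + v) = nsq u + nsq v := by rw [nsq_add, h]; simp

lemma norm_dotProduct_sq_le {n : ℕ} (u v : Fin n → ℂ) : ‖u ⬝ᵥ v‖ ^ 2 ≤ nsq u * nsq v := by
  calc ‖u ⬝ᵥ v‖ ^ 2 ≤ (∑ i, ‖u i‖ * ‖v i‖) ^ 2 := by
        gcongr
        exact (norm_sum_le _ _).trans_eq (by simp)
    _ ≤ _ := Finset.sum_mul_sq_le_sq_mul_sq _ _ _

lemma prob_nonneg {m n : ℕ} (Y : Matrix (Fin m) (Fin n) ℂ) : 0 ≤ prob Y := by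
  unfold prob; positivity

lemma prob_eq_sum_rows {m n : ℕ} (Y : Matrix (Fin m) (Fin n) ℂ) : prob Y = ∑ i, nsq (Y i) := rfl

lemma prob_conjTranspose {m n : ℕ} (Y : Matrix (Fin m) (Fin n) ℂ) : prob Yᴴ = prob Y := by
  simp only [prob, Matrix.conjTranspose_apply, norm_star]
  exact Finset.sum_comm

lemma prob_transpose {m n : ℕ} (Y : Matrix (Fin m) (Fin n) ℂ) : prob Yᵀ = prob Y := by
  simp only [prob, Matrix.transpose_apply]
  exact Finset.sum_comm

lemma prob_eq_trace {m n : ℕ} (Y : Matrix (Fin m) (Fin n) ℂ) :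
    (prob Y : ℂ) = (Yᴴ * Y).trace := by
  rw [← prob_transpose]
  simp [prob, Matrix.trace, Matrix.mul_apply, Complex.conj_mul']

lemma prob_smul {m n : ℕ} (c : ℂ) (Y : Matrix (Fin m) (Fin n) ℂ) :
    prob (c • Y) = ‖c‖ ^ 2 * prob Y := by
  simp [prob, Finset.mul_sum, mul_pow]

lemma prob_normalized {m n : ℕ} {Y : Matrix (Fin m) (Fin n) ℂ} (h : 0 < prob Y) :
    prob (normalized Y) = 1 := by
  rw [normalized, prob_smul, norm_inv, inv_pow]
  simp [Real.sq_sqrt h.le, abs_of_nonneg (Real.sqrt_nonneg _), h.ne']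

lemma normalized_of_prob_eq_one {m n : ℕ} {Y : Matrix (Fin m) (Fin n) ℂ} (h : prob Y = 1) :
    normalized Y = Y := by simp [normalized, h]

lemma nsq_mulVec_le {m n : ℕ} (Y : Matrix (Fin m) (Fin n) ℂ) (v : Fin n → ℂ) :
    nsq (Y *ᵥ v) ≤ prob Y * nsq v := by
  rw [prob_eq_sum_rows, Finset.sum_mul]
  exact Finset.sum_le_sum fun i _ => norm_dotProduct_sq_le _ _

lemma star_vecMul_eq {m n : ℕ} (Y : Matrix (Fin m) (Fin n) ℂ) (e : Fin m → ℂ) :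
    star e ᵥ* Y = star (Yᴴ *ᵥ e) := by
  rw [Matrix.star_mulVec, Matrix.conjTranspose_conjTranspose]

lemma nsq_vecMul_le {m n : ℕ} (Y : Matrix (Fin m) (Fin n) ℂ) (e : Fin m → ℂ) :
    nsq (star e ᵥ* Y) ≤ nsq e * prob Y := by
  rw [star_vecMul_eq, nsq_star, mul_comm, ← prob_conjTranspose]
  exact nsq_mulVec_le _ _

lemma nsq_sub_proj {n : ℕ} (y f : Fin n → ℂ) :
    nsq ((nsq f : ℂ) • y - (y ⬝ᵥ f) • star f) =
      nsq f * (nsq f * nsq y - ‖y ⬝ᵥ f‖ ^ 2) := by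
  rw [sub_eq_add_neg, nsq_add, ← neg_smul, nsq_smul, nsq_smul, nsq_star, dotProduct_smul,
    star_smul, smul_dotProduct, Matrix.star_dotProduct_star, dotProduct_comm f y]
  have h0 := nsq_nonneg f
  simp only [Complex.norm_real, norm_neg, Real.norm_eq_abs, sq_abs, smul_eq_mul, Complex.star_def,
    Complex.conj_ofReal]
  have : ((-(y ⬝ᵥ f)) * ((nsq f : ℂ) * (starRingEnd ℂ) (y ⬝ᵥ f))).re
      = - (nsq f * ‖y ⬝ᵥ f‖ ^ 2) := by
    have : (-(y ⬝ᵥ f)) * ((nsq f : ℂ) * (starRingEnd ℂ) (y ⬝ᵥ f))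
      = ((-(nsq f * ‖y ⬝ᵥ f‖ ^ 2) : ℝ) : ℂ) := by
      push_cast
      rw [← Complex.mul_conj']; ring
    rw [this, Complex.ofReal_re]
  rw [this]; ring

/-- Positivity of `tr ((|e|² - e e†) Y (|f|² - f f†) Y†)`. -/
lemma proj_proj_nonneg {m n : ℕ} (Y : Matrix (Fin m) (Fin n) ℂ) (e : Fin m → ℂ)
    (f : Fin n → ℂ) :
    nsq f * nsq (star e ᵥ* Y) + nsq e * nsq (Y *ᵥ f) ≤
      nsq e * nsq f * prob Y + ‖star e ⬝ᵥ (Y *ᵥ f)‖ ^ 2 := by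
  rcases (nsq_nonneg f).eq_or_lt with h | h
  · rw [eq_comm, nsq_eq_zero] at h
    simp [h, nsq]
  -- `W = Y (|f|² - f f†)`. The claim is `|e† W|² ≤ |e|² ‖W‖²` with a factor `|f|²` cancelled.
  set W : Matrix (Fin m) (Fin n) ℂ :=
    (nsq f : ℂ) • Y - Matrix.vecMulVec (Y *ᵥ f) (star f) with hW
  have h1 : prob W = nsq f * (nsq f * prob Y - nsq (Y *ᵥ f)) := by
    rw [prob_eq_sum_rows, prob_eq_sum_rows]
    have : ∀ i, nsq (W i) = nsq f * (nsq f * nsq (Y i) - ‖(Y *ᵥ f) i‖ ^ 2) := fun i =>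
      nsq_sub_proj (Y i) f
    simp only [this, ← Finset.mul_sum, Finset.sum_sub_distrib]
    rfl
  have h2 : nsq (star e ᵥ* W) =
      nsq f * (nsq f * nsq (star e ᵥ* Y) - ‖star e ⬝ᵥ (Y *ᵥ f)‖ ^ 2) := by
    rw [Matrix.dotProduct_mulVec, ← nsq_sub_proj, hW, Matrix.vecMul_sub, Matrix.vecMul_smul,
      Matrix.vecMul_vecMulVec, Matrix.dotProduct_mulVec]
  have h3 := nsq_vecMul_le W e
  rw [h1, h2, mul_left_comm] at h3
  have := le_of_mul_le_mul_left h3 h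
  linarith


/-! ### The largest singular value -/

/-- The square of the largest singular value of `Y`. -/
def top {m n : ℕ} (Y : Matrix (Fin m) (Fin n) ℂ) : ℝ :=
  sSup ((fun v => nsq (Y *ᵥ v)) '' {v | nsq v = 1})

lemma bddAbove_top {m n : ℕ} (Y : Matrix (Fin m) (Fin n) ℂ) :
    BddAbove ((fun v => nsq (Y *ᵥ v)) '' {v | nsq v = 1}) := by
  refine ⟨prob Y, ?_⟩
  rintro _ ⟨v, hv, rfl⟩
  have := nsq_mulVec_le Y v
  rwa [show nsq v = 1 from hv, mul_one] at this

lemma nsq_mulVec_le_top_of_unit {m n : ℕ} (Y : Matrix (Fin m) (Fin n) ℂ) {v : Fin n → ℂ}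
    (hv : nsq v = 1) : nsq (Y *ᵥ v) ≤ top Y :=
  le_csSup (bddAbove_top Y) ⟨v, hv, rfl⟩

lemma top_nonneg {m n : ℕ} (Y : Matrix (Fin m) (Fin n) ℂ) : 0 ≤ top Y := by
  apply Real.sSup_nonneg
  rintro _ ⟨v, -, rfl⟩
  exact nsq_nonneg _

lemma top_le_prob {m n : ℕ} (Y : Matrix (Fin m) (Fin n) ℂ) : top Y ≤ prob Y := by
  apply Real.sSup_le _ (prob_nonneg Y)
  rintro _ ⟨v, hv, rfl⟩
  have := nsq_mulVec_le Y v
  rwa [show nsq v = 1 from hv, mul_one] at this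

lemma nsq_mulVec_le_top {m n : ℕ} (Y : Matrix (Fin m) (Fin n) ℂ) (v : Fin n → ℂ) :
    nsq (Y *ᵥ v) ≤ top Y * nsq v := by
  rcases (nsq_nonneg v).eq_or_lt with h | h
  · rw [eq_comm, nsq_eq_zero] at h
    simp [h, nsq]
  · have h1 : ‖(((Real.sqrt (nsq v))⁻¹ : ℝ) : ℂ)‖ ^ 2 = (nsq v)⁻¹ := by
      rw [Complex.norm_real, Real.norm_eq_abs, sq_abs, inv_pow, Real.sq_sqrt h.le]
    have h2 := nsq_mulVec_le_top_of_unit Y (v := (((Real.sqrt (nsq v))⁻¹ : ℝ) : ℂ) • v)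
      (by rw [nsq_smul, h1, inv_mul_cancel₀ h.ne'])
    rw [Matrix.mulVec_smul, nsq_smul, h1, inv_mul_eq_div, div_le_iff₀ h] at h2
    exact h2

/-- `Y` and `Yᴴ` have the same operator norm: by Cauchy–Schwarz `|Y†w|⁴ = ⟨w, Y Y†w⟩² ≤ |w|² · top Y
· |Y†w|²`. -/
lemma nsq_conjTranspose_mulVec_le_top {m n : ℕ} (Y : Matrix (Fin m) (Fin n) ℂ)
    (w : Fin m → ℂ) : nsq (Yᴴ *ᵥ w) ≤ top Y * nsq w := by
  rcases (nsq_nonneg (Yᴴ *ᵥ w)).eq_or_lt with h | h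
  · rw [← h]; exact mul_nonneg (top_nonneg Y) (nsq_nonneg w)
  have h1 := norm_dotProduct_sq_le (star w) (Y *ᵥ (Yᴴ *ᵥ w))
  rw [Matrix.dotProduct_mulVec, star_vecMul_eq, star_dotProduct_self, Complex.norm_real,
    Real.norm_eq_abs, sq_abs, nsq_star] at h1
  have h2 := nsq_mulVec_le_top Y (Yᴴ *ᵥ w)
  have h3 : nsq (Yᴴ *ᵥ w) * nsq (Yᴴ *ᵥ w) ≤ nsq (Yᴴ *ᵥ w) * (top Y * nsq w) := by
    nlinarith [mul_le_mul_of_nonneg_left h2 (nsq_nonneg w)]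
  exact le_of_mul_le_mul_left h3 h

lemma nsq_vecMul_le_top {m n : ℕ} (Y : Matrix (Fin m) (Fin n) ℂ) {w : Fin m → ℂ}
    (hw : nsq w = 1) : nsq (star w ᵥ* Y) ≤ top Y := by
  rw [star_vecMul_eq, nsq_star]
  simpa [hw] using nsq_conjTranspose_mulVec_le_top Y w

lemma isCompact_sphere_nsq (n : ℕ) : IsCompact {v : Fin n → ℂ | nsq v = 1} := by
  refine Metric.isCompact_of_isClosed_isBounded ?_ ?_
  · exact isClosed_eq (by unfold nsq; fun_prop) continuous_const
  · refine Metric.isBounded_closedBall (x := (0 : Fin n → ℂ)) (r := 1) |>.subset ?_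
    intro v hv
    rw [mem_closedBall_zero_iff, pi_norm_le_iff_of_nonneg zero_le_one]
    intro i
    have h1 : ‖v i‖ ^ 2 ≤ nsq v :=
      Finset.single_le_sum (f := fun i => ‖v i‖ ^ 2) (fun i _ => by positivity) (Finset.mem_univ i)
    rw [show nsq v = 1 from hv] at h1
    exact (sq_le_one_iff₀ (norm_nonneg _)).1 h1

lemma exists_unit_nsq_eq_top {m n : ℕ} (Y : Matrix (Fin m) (Fin n) ℂ) (hn : 0 < n) :
    ∃ k, nsq k = 1 ∧ nsq (Y *ᵥ k) = top Y := by
  have hne : {v : Fin n → ℂ | nsq v = 1}.Nonempty :=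
    ⟨Pi.single ⟨0, hn⟩ 1, by
      simp only [Set.mem_ofPred_eq, nsq]
      rw [Finset.sum_eq_single ⟨0, hn⟩] <;> simp +contextual⟩
  obtain ⟨k, hk, hmax⟩ := (isCompact_sphere_nsq n).exists_isMaxOn hne
    (f := fun v => nsq (Y *ᵥ v))
    (by unfold nsq; simp only [Matrix.mulVec, dotProduct]; fun_prop)
  refine ⟨k, hk, le_antisymm (nsq_mulVec_le_top_of_unit Y hk) ?_⟩
  refine csSup_le (hne.image _) ?_
  rintro _ ⟨v, hv, rfl⟩
  exact hmax hv

lemma top_pos {m n : ℕ} {Y : Matrix (Fin m) (Fin n) ℂ} (h : 0 < prob Y) : 0 < top Y := by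
  by_contra hc
  have h0 : top Y = 0 := le_antisymm (not_lt.1 hc) (top_nonneg Y)
  have : Y = 0 := by
    ext i j
    have h1 := nsq_mulVec_le_top Y (Pi.single j 1)
    rw [h0, zero_mul] at h1
    have h2 := nsq_eq_zero.1 (le_antisymm h1 (nsq_nonneg _))
    simpa using congrFun h2 i
  simp [this, prob] at h

/-- A maximizer `k` of `|Yk|²` on the compact unit sphere is a right singular vector, and `g` is the
direction of `Yk`. -/
lemma exists_singular_pair {m n : ℕ} {Y : Matrix (Fin m) (Fin n) ℂ} (h : 0 < prob Y) :
    ∃ (g : Fin m → ℂ) (k : Fin n → ℂ) (σ : ℝ), 0 < σ ∧ nsq g = 1 ∧ nsq k = 1 ∧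
      Y *ᵥ k = (σ : ℂ) • g ∧ Yᴴ *ᵥ g = (σ : ℂ) • k ∧ σ ^ 2 = top Y := by
  have hn : 0 < n := by
    rcases Nat.eq_zero_or_pos n with rfl | hn
    · simp [prob] at h
    · exact hn
  obtain ⟨k, hk, hY⟩ := exists_unit_nsq_eq_top Y hn
  have ht := top_pos h
  set σ := Real.sqrt (top Y) with hσ
  have hσ0 : 0 < σ := Real.sqrt_pos.2 ht
  have hσ2 : σ ^ 2 = top Y := Real.sq_sqrt ht.le
  have hσc : (σ : ℂ) ≠ 0 := by exact_mod_cast hσ0.ne'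
  -- With `t = top Y`, expanding gives `|Y†Yk - t k|² ≤ t² - 2t² + t² = 0`.
  have hYY : Yᴴ *ᵥ (Y *ᵥ k) = (top Y : ℂ) • k := by
    rw [← sub_eq_zero, ← nsq_eq_zero]
    refine le_antisymm ?_ (nsq_nonneg _)
    have h1 := nsq_conjTranspose_mulVec_le_top Y (Y *ᵥ k)
    rw [hY] at h1
    have h2 : star (Yᴴ *ᵥ (Y *ᵥ k)) ⬝ᵥ k = (top Y : ℂ) := by
      rw [← star_vecMul_eq, ← Matrix.dotProduct_mulVec, star_dotProduct_self, hY]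
    rw [sub_eq_add_neg, nsq_add, ← neg_smul, nsq_smul, dotProduct_smul, h2, hk, norm_neg,
      Complex.norm_real, Real.norm_eq_abs, sq_abs, smul_eq_mul]
    have : (-(top Y : ℂ) * (top Y : ℂ)).re = - (top Y * top Y) := by
      rw [← Complex.ofReal_neg, ← Complex.ofReal_mul, Complex.ofReal_re]; ring
    rw [this]; nlinarith
  refine ⟨(σ : ℂ)⁻¹ • (Y *ᵥ k), k, σ, hσ0, ?_, hk, ?_, ?_, hσ2⟩
  · rw [nsq_smul, hY, norm_inv, Complex.norm_real, Real.norm_eq_abs, inv_pow, sq_abs, hσ2,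
      inv_mul_cancel₀ ht.ne']
  · rw [smul_smul, mul_inv_cancel₀ hσc, one_smul]
  · rw [Matrix.mulVec_smul, hYY, smul_smul, ← hσ2]
    congr 1
    push_cast
    field_simp


/-! ### The variational bound on the concurrence -/

/-- The squared Frobenius norm of `S Y T`, where `S = √α` on the unit vector `e` and `S = √A` on its
complement, and similarly `T = √β`, `√B` with respect to the unit vector `f`. -/
def weight {m n : ℕ} (A α B β : ℝ) (Y : Matrix (Fin m) (Fin n) ℂ) (e : Fin m → ℂ)
    (f : Fin n → ℂ) : ℝ :=
  A * B * prob Y - B * (A - α) * nsq (star e ᵥ* Y) - A * (B - β) * nsq (Y *ᵥ f)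
    + (A - α) * (B - β) * ‖star e ⬝ᵥ (Y *ᵥ f)‖ ^ 2

/-- The largest Schmidt number of the best two-level state into which the (unnormalized) state `Y`
can be purified deterministically. -/
def head {m n : ℕ} (Y : Matrix (Fin m) (Fin n) ℂ) : ℝ := max (prob Y / 2) (top Y)

/-- Cauchy–Schwarz gives `√(PQ) ≥ 1 + XY`, and AM–GM gives `P x² + Q y² ≥ 2 √(PQ) x y`. -/
lemma two_mul_sqrt_mul_le {P Q X Y x y : ℝ} (hP : 0 ≤ P) (hQ : 0 ≤ Q)
    (hx : 0 ≤ x) (hy : 0 ≤ y) (h : P * Q = (1 + X ^ 2) * (1 + Y ^ 2)) :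
    2 * (x * y) ≤ P * x ^ 2 + Q * y ^ 2 - 2 * (x * y) * (X * Y) := by
  have h1 : 1 + X * Y ≤ Real.sqrt P * Real.sqrt Q := by
    rw [← Real.sqrt_mul hP]
    apply Real.le_sqrt_of_sq_le
    rw [h]; nlinarith [sq_nonneg (X - Y)]
  have h2 := mul_le_mul_of_nonneg_left h1 (mul_nonneg hx hy)
  nlinarith [sq_nonneg (Real.sqrt P * x - Real.sqrt Q * y), Real.sq_sqrt hP, Real.sq_sqrt hQ]

/-- The scalar core after deflation `Y = Z + σ g k†`. Here `e`, `f` are the overlaps of the two test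
vectors with `g`, `k`, and `n = ‖Z‖²`. With `e'`, `f'` the parts of the test vectors orthogonal to
`g`, `k`, the numbers `r`, `q`, `z` stand for `|e'†Z|²`, `|Z f'|²`, `|e'†Z f'|`, and `s` for the
corner `|e†Y f|²`. The extremal case is `r = εn`, `q = φn`, `z² = εφn` with `ε = 1 - e²`, `φ = 1 -
f²`; it is handled by `two_mul_sqrt_mul_le`, and the other hypotheses control the deviation from it.
-/
lemma weight_scalar_bound {A α B β e f n r q z s σ : ℝ} (hα : 0 ≤ α) (hβ : 0 ≤ β)
    (hA : A * α = 1) (hB : B * β = 1) (hαA : α ≤ A) (hβB : β ≤ B)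
    (he : 0 ≤ e) (hf : 0 ≤ f) (he1 : e ^ 2 ≤ 1) (hf1 : f ^ 2 ≤ 1) (hσ : 0 ≤ σ) (hn : 0 ≤ n)
    (hr : r ≤ (1 - e ^ 2) * n) (hq : q ≤ (1 - f ^ 2) * n)
    (hzz : z ^ 2 ≤ (1 - e ^ 2) * (1 - f ^ 2) * n)
    (h : (1 - f ^ 2) * r + (1 - e ^ 2) * q ≤ (1 - e ^ 2) * (1 - f ^ 2) * n + z ^ 2)
    (hs : (σ * e * f - z) ^ 2 ≤ s) :
    2 * (σ * Real.sqrt n) ≤ A * B * (σ ^ 2 + n) - B * (A - α) * (e ^ 2 * σ ^ 2 + r)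
      - A * (B - β) * (f ^ 2 * σ ^ 2 + q) + (A - α) * (B - β) * s := by
  obtain ⟨D, hD⟩ : ∃ D, D = A - α := ⟨_, rfl⟩
  obtain ⟨D', hD'⟩ : ∃ D', D' = B - β := ⟨_, rfl⟩
  obtain ⟨ε, hε⟩ : ∃ ε, ε = 1 - e ^ 2 := ⟨_, rfl⟩
  obtain ⟨φ, hφ⟩ : ∃ φ, φ = 1 - f ^ 2 := ⟨_, rfl⟩
  rw [← hε] at hr hzz h
  rw [← hφ] at hq hzz h
  have hD0 : 0 ≤ D := by linarith
  have hD0' : 0 ≤ D' := by linarith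
  have hε0 : 0 ≤ ε := by linarith
  have hφ0 : 0 ≤ φ := by linarith
  have hε1 : ε ≤ 1 := by nlinarith
  have hφ1 : φ ≤ 1 := by nlinarith
  have hH1 : 0 ≤ A - D * e ^ 2 := by nlinarith
  have hH2 : 0 ≤ A - D * ε := by nlinarith
  have hG1 : 0 ≤ B - D' * f ^ 2 := by nlinarith
  have hG2 : 0 ≤ B - D' * φ := by nlinarith
  -- On a plane containing the test vector, `S²` has determinant `Aα = 1`: the product of its
  -- diagonal entries is one plus the square of the off-diagonal one.
  have hHH : (A - D * e ^ 2) * (A - D * ε) = 1 + (D * e * Real.sqrt ε) ^ 2 := by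
    rw [mul_pow, Real.sq_sqrt hε0, hD, hε]; linear_combination hA
  have hGG : (B - D' * f ^ 2) * (B - D' * φ) = 1 + (D' * f * Real.sqrt φ) ^ 2 := by
    rw [mul_pow, Real.sq_sqrt hφ0, hD', hφ]; linear_combination hB
  have key := two_mul_sqrt_mul_le (P := (A - D * e ^ 2) * (B - D' * f ^ 2))
    (Q := (A - D * ε) * (B - D' * φ)) (X := D * e * Real.sqrt ε) (Y := D' * f * Real.sqrt φ)
    (x := σ) (y := Real.sqrt n) (by positivity) (by positivity)
    hσ (by positivity) (by rw [← hHH, ← hGG]; ring)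
  rw [Real.sq_sqrt hn] at key
  have hz' : z ≤ Real.sqrt ε * Real.sqrt φ * Real.sqrt n := by
    rw [← Real.sqrt_mul hε0, ← Real.sqrt_mul (mul_nonneg hε0 hφ0)]
    exact Real.le_sqrt_of_sq_le hzz
  have h3 := mul_le_mul_of_nonneg_left hz' (by positivity : 0 ≤ D * D' * σ * e * f)
  have h4 := mul_nonneg (mul_nonneg hD0 hG2) (sub_nonneg.2 hr)
  have h5 := mul_nonneg (mul_nonneg hD0' hH2) (sub_nonneg.2 hq)
  have h6 := mul_le_mul_of_nonneg_left h (mul_nonneg hD0 hD0')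
  have h7 := mul_le_mul_of_nonneg_left hs (mul_nonneg hD0 hD0')
  rw [← hD, ← hD']
  linarith

lemma nsq_sub_proj_unit {n : ℕ} {g : Fin n → ℂ} (hg : nsq g = 1) (e : Fin n → ℂ) :
    nsq (e - (star g ⬝ᵥ e) • g) = nsq e - ‖star g ⬝ᵥ e‖ ^ 2 := by
  have h : star (e - (star g ⬝ᵥ e) • g) ⬝ᵥ ((star g ⬝ᵥ e) • g) = 0 := by
    rw [dotProduct_smul, star_sub, sub_dotProduct, star_smul, smul_dotProduct,
      star_dotProduct_self, hg, ← Matrix.star_dotProduct]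
    simp
  have h1 := nsq_add_of_orthogonal h
  rw [sub_add_cancel, nsq_smul, hg] at h1
  linarith

/-- Deflation: subtracting the leading singular component. -/
lemma exists_deflation {m n : ℕ} {Y : Matrix (Fin m) (Fin n) ℂ} (h : 0 < prob Y) :
    ∃ (g : Fin m → ℂ) (k : Fin n → ℂ) (σ : ℝ) (Z : Matrix (Fin m) (Fin n) ℂ), 0 < σ ∧
      nsq g = 1 ∧ nsq k = 1 ∧ σ ^ 2 = top Y ∧ Y = Z + (σ : ℂ) • Matrix.vecMulVec g (star k) ∧
      Z *ᵥ k = 0 ∧ star g ᵥ* Z = 0 ∧ prob Z = prob Y - σ ^ 2 := by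
  obtain ⟨g, k, σ, hσ, hg, hk, hYk, hYg, ht⟩ := exists_singular_pair h
  have hkk : star k ⬝ᵥ k = 1 := by rw [star_dotProduct_self, hk]; simp
  have hgg : star g ⬝ᵥ g = 1 := by rw [star_dotProduct_self, hg]; simp
  have hZk : (Y - (σ : ℂ) • Matrix.vecMulVec g (star k)) *ᵥ k = 0 := by
    rw [Matrix.sub_mulVec, Matrix.smul_mulVec, hYk, Matrix.vecMulVec_mulVec, hkk]
    simp
  have hgZ : star g ᵥ* (Y - (σ : ℂ) • Matrix.vecMulVec g (star k)) = 0 := by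
    rw [Matrix.vecMul_sub, Matrix.vecMul_smul, Matrix.vecMul_vecMulVec, hgg, star_vecMul_eq, hYg,
      star_smul]
    simp
  refine ⟨g, k, σ, Y - (σ : ℂ) • Matrix.vecMulVec g (star k), hσ, hg, hk, ht, by simp, hZk, hgZ, ?_⟩
  have h1 : ∀ i, nsq (Y i) = nsq ((Y - (σ : ℂ) • Matrix.vecMulVec g (star k)) i)
      + σ ^ 2 * ‖g i‖ ^ 2 := by
    intro i
    have e1 : Y i = (((σ : ℂ) * g i) • star k)
        + (Y - (σ : ℂ) • Matrix.vecMulVec g (star k)) i := by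
      ext j
      simp [Matrix.vecMulVec_apply, mul_assoc]
    conv_lhs => rw [e1]
    rw [nsq_add_of_orthogonal, nsq_smul, nsq_star, hk]
    · simp [mul_pow]; ring
    · rw [star_smul, star_star, smul_dotProduct, dotProduct_comm]
      have := congrFun hZk i
      rw [Matrix.mulVec] at this
      rw [this]; simp
  rw [prob_eq_sum_rows Y, Finset.sum_congr rfl fun i _ => h1 i, Finset.sum_add_distrib,
    ← Finset.mul_sum, ← prob_eq_sum_rows, show ∑ i, ‖g i‖ ^ 2 = nsq g from rfl, hg]
  ring

/-- All Schmidt numbers but the largest are lumped into one level of weight `prob Y - top Y`, the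
squared norm of the deflated matrix. Only the components of `e`, `f` orthogonal to the leading
singular vectors meet that matrix. -/
theorem two_mul_sqrt_top_le_weight {m n : ℕ} {A α B β : ℝ} (hα : 0 ≤ α) (hβ : 0 ≤ β)
    (hA : A * α = 1) (hB : B * β = 1) (hαA : α ≤ A) (hβB : β ≤ B)
    {Y : Matrix (Fin m) (Fin n) ℂ} (hY : 0 < prob Y) {e : Fin m → ℂ} {f : Fin n → ℂ}
    (he : nsq e = 1) (hf : nsq f = 1) :
    2 * Real.sqrt (top Y * (prob Y - top Y)) ≤ weight A α B β Y e f := by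
  obtain ⟨g, k, σ, Z, hσ, hg, hk, ht, hYZ, hZk, hgZ, hp⟩ := exists_deflation hY
  set e' := e - (star g ⬝ᵥ e) • g with he'
  set f' := f - (star k ⬝ᵥ f) • k with hf'
  have hne : nsq e' = 1 - ‖star g ⬝ᵥ e‖ ^ 2 := by rw [he', nsq_sub_proj_unit hg, he]
  have hnf : nsq f' = 1 - ‖star k ⬝ᵥ f‖ ^ 2 := by rw [hf', nsq_sub_proj_unit hk, hf]
  have hZf : Z *ᵥ f' = Z *ᵥ f := by
    rw [hf', Matrix.mulVec_sub, Matrix.mulVec_smul, hZk]; simp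
  have heZ : star e' ᵥ* Z = star e ᵥ* Z := by
    rw [he', star_sub, Matrix.sub_vecMul, star_smul, Matrix.smul_vecMul, hgZ]; simp
  have hcor : star e' ⬝ᵥ (Z *ᵥ f') = star e ⬝ᵥ (Z *ᵥ f) := by
    rw [hZf, Matrix.dotProduct_mulVec, heZ, ← Matrix.dotProduct_mulVec]
  have hYf : Y *ᵥ f = ((σ : ℂ) * (star k ⬝ᵥ f)) • g + Z *ᵥ f := by
    rw [hYZ, Matrix.add_mulVec, Matrix.smul_mulVec, Matrix.vecMulVec_mulVec, add_comm]
    simp [smul_smul]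
  have heY : star e ᵥ* Y = ((σ : ℂ) * (star e ⬝ᵥ g)) • star k + star e ᵥ* Z := by
    rw [hYZ, Matrix.vecMul_add, Matrix.vecMul_smul, Matrix.vecMul_vecMulVec, add_comm]
    simp [smul_smul]
  have hge : ‖star e ⬝ᵥ g‖ = ‖star g ⬝ᵥ e‖ := by rw [Matrix.star_dotProduct, norm_star]
  have nYf : nsq (Y *ᵥ f) = ‖star k ⬝ᵥ f‖ ^ 2 * σ ^ 2 + nsq (Z *ᵥ f') := by
    rw [hYf, nsq_add_of_orthogonal, nsq_smul, hg, hZf]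
    · simp [mul_pow]; ring
    · rw [star_smul, smul_dotProduct, Matrix.dotProduct_mulVec, hgZ]; simp
  have neY : nsq (star e ᵥ* Y) = ‖star g ⬝ᵥ e‖ ^ 2 * σ ^ 2 + nsq (star e' ᵥ* Z) := by
    rw [heY, nsq_add_of_orthogonal, nsq_smul, nsq_star, hk, heZ]
    · simp [mul_pow, hge]; ring
    · rw [star_smul, smul_dotProduct, star_star, dotProduct_comm k, ← Matrix.dotProduct_mulVec, hZk]
      simp
  have hc : star e ⬝ᵥ (Y *ᵥ f) =
      ((σ : ℂ) * (star k ⬝ᵥ f)) * (star e ⬝ᵥ g) + star e' ⬝ᵥ (Z *ᵥ f') := by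
    rw [hYf, dotProduct_add, dotProduct_smul, hcor, smul_eq_mul]
  -- Reverse triangle inequality: in the worst case the two contributions to the corner have
  -- opposite phases.
  have hs : (σ * ‖star g ⬝ᵥ e‖ * ‖star k ⬝ᵥ f‖ - ‖star e' ⬝ᵥ (Z *ᵥ f')‖) ^ 2
      ≤ ‖star e ⬝ᵥ (Y *ᵥ f)‖ ^ 2 := by
    apply sq_le_sq'
    · rw [hc]
      have := norm_sub_norm_le (star e' ⬝ᵥ (Z *ᵥ f')) (-(((σ : ℂ) * (star k ⬝ᵥ f)) * (star e ⬝ᵥ g)))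
      rw [sub_neg_eq_add, norm_neg, add_comm (star e' ⬝ᵥ _)] at this
      simp only [norm_mul, Complex.norm_real, Real.norm_eq_abs, abs_of_pos hσ, hge] at this
      linarith
    · rw [hc]
      have := norm_sub_norm_le (((σ : ℂ) * (star k ⬝ᵥ f)) * (star e ⬝ᵥ g)) (-(star e' ⬝ᵥ (Z *ᵥ f')))
      rw [sub_neg_eq_add, norm_neg] at this
      simp only [norm_mul, Complex.norm_real, Real.norm_eq_abs, abs_of_pos hσ, hge] at this
      linarith
  have hpZ : 0 ≤ prob Z := prob_nonneg Z
  have b1 := nsq_vecMul_le Z e'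
  have b2 := nsq_mulVec_le Z f'
  have b3 := proj_proj_nonneg Z e' f'
  have b4 := (norm_dotProduct_sq_le (star e') (Z *ᵥ f')).trans
    (mul_le_mul_of_nonneg_left b2 (nsq_nonneg _))
  rw [nsq_star] at b4
  rw [hne] at b1 b3 b4
  rw [hnf] at b2 b3 b4
  have e0 : ‖star g ⬝ᵥ e‖ ^ 2 ≤ 1 := by linarith [nsq_nonneg e']
  have f0 : ‖star k ⬝ᵥ f‖ ^ 2 ≤ 1 := by linarith [nsq_nonneg f']
  have main := weight_scalar_bound hα hβ hA hB hαA hβB (norm_nonneg _) (norm_nonneg _) e0 f0 hσ.le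
    hpZ b1 (by linarith) (by linarith) b3 hs
  rw [← ht, Real.sqrt_mul (sq_nonneg σ), Real.sqrt_sq hσ.le, ← hp, weight, nYf, neY]
  rw [show prob Y = σ ^ 2 + prob Z by linarith]
  exact main

theorem concurrence_le_weight {m n : ℕ} {A α B β : ℝ} (hα : 0 ≤ α) (hβ : 0 ≤ β)
    (hA : A * α = 1) (hB : B * β = 1) (hαA : α ≤ A) (hβB : β ≤ B)
    {Y : Matrix (Fin m) (Fin n) ℂ} (hY : 0 < prob Y) {e : Fin m → ℂ} {f : Fin n → ℂ}
    (he : nsq e = 1) (hf : nsq f = 1) :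
    2 * Real.sqrt (head Y * (prob Y - head Y)) ≤ weight A α B β Y e f := by
  rcases le_total (prob Y / 2) (top Y) with h | h
  · rw [head, max_eq_right h]
    exact two_mul_sqrt_top_le_weight hα hβ hA hB hαA hβB hY he hf
  · rw [head, max_eq_left h, show prob Y / 2 * (prob Y - prob Y / 2) = (prob Y / 2) ^ 2 by ring,
      Real.sqrt_sq (by linarith), weight]
    have h1 := (nsq_vecMul_le_top Y he).trans h
    have h2 := (nsq_mulVec_le_top_of_unit Y hf).trans h
    have hA0 : 0 ≤ A := hα.trans hαA
    have hB0 : 0 ≤ B := hβ.trans hβB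
    have h3 := mul_le_mul_of_nonneg_left h1 (mul_nonneg hB0 (sub_nonneg.2 hαA))
    have h4 := mul_le_mul_of_nonneg_left h2 (mul_nonneg hA0 (sub_nonneg.2 hβB))
    have h5 : 0 ≤ (A - α) * (B - β) * ‖star e ⬝ᵥ (Y *ᵥ f)‖ ^ 2 :=
      mul_nonneg (mul_nonneg (sub_nonneg.2 hαA) (sub_nonneg.2 hβB)) (sq_nonneg _)
    -- When no Schmidt number exceeds half, dropping the corner leaves `weight ≥ (prob Y / 2)(Bα +
    -- Aβ)`. The two summands are reciprocal, so their sum is at least `2`.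
    have h6 : (B * α) * (A * β) = 1 := by linear_combination B * β * hA + hB
    have h7 : 2 ≤ B * α + A * β := by
      have : 0 ≤ B * α := mul_nonneg hB0 hα
      have : 0 ≤ A * β := mul_nonneg hA0 hβ
      nlinarith [sq_nonneg (B * α - A * β)]
    nlinarith [mul_le_mul_of_nonneg_left h7 hY.le]


/-! ### Averages over measurement outcomes -/

lemma exists_le_of_weighted_sum_le {k : ℕ} {p x : Fin k → ℝ} {c : ℝ} (hp : ∀ α, 0 ≤ p α)
    (h1 : ∑ α, p α = 1) (hx : ∑ α, p α * x α ≤ c) : ∃ α, 0 < p α ∧ x α ≤ c := by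
  by_contra! hc
  obtain ⟨α, hα⟩ : ∃ α, 0 < p α := by
    by_contra! h
    have : ∑ α, p α ≤ 0 := Finset.sum_nonpos fun α _ => h α
    linarith
  have : ∑ α, p α * c < ∑ α, p α * x α := by
    refine Finset.sum_lt_sum (fun β _ => ?_) ⟨α, Finset.mem_univ α, ?_⟩
    · rcases (hp β).eq_or_lt with h | h
      · simp [← h]
      · exact mul_le_mul_of_nonneg_left (hc β h).le h.le
    · exact mul_lt_mul_of_pos_left (hc α hα) hα
  rw [← Finset.sum_mul, h1, one_mul] at this
  linarith

lemma normSq_inv_sqrt {x : ℝ} (h : 0 ≤ x) : ‖(((Real.sqrt x : ℝ) : ℂ))⁻¹‖ ^ 2 = x⁻¹ := by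
  rw [norm_inv, Complex.norm_real, Real.norm_eq_abs, inv_pow, sq_abs, Real.sq_sqrt h]

/-! ### Local measurements -/

lemma IsLocalMeasurement.sum_nsq {k m : ℕ} {r : Fin k → ℕ}
    {M : ∀ α, Matrix (Fin (r α)) (Fin m) ℂ} (hM : IsLocalMeasurement M) (v : Fin m → ℂ) :
    ∑ α, nsq (M α *ᵥ v) = nsq v := by
  have h : ((∑ α, nsq (M α *ᵥ v) : ℝ) : ℂ) = (nsq v : ℂ) := by
    push_cast
    calc ∑ α, (nsq (M α *ᵥ v) : ℂ) = ∑ α, star v ⬝ᵥ (((M α)ᴴ * M α) *ᵥ v) := by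
          refine Finset.sum_congr rfl fun α _ => ?_
          rw [← star_dotProduct_self, Matrix.star_mulVec, ← Matrix.mulVec_mulVec,
            Matrix.dotProduct_mulVec _ (M α)ᴴ]
      _ = star v ⬝ᵥ ((∑ α, (M α)ᴴ * M α) *ᵥ v) := by
          rw [Matrix.sum_mulVec, dotProduct_sum]
      _ = _ := by rw [hM, Matrix.one_mulVec, star_dotProduct_self]
  exact_mod_cast h

lemma prob_mul_eq_sum {l m n : ℕ} (M : Matrix (Fin l) (Fin m) ℂ) (Y : Matrix (Fin m) (Fin n) ℂ) :
    prob (M * Y) = ∑ j, nsq (M *ᵥ Y.col j) := by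
  rw [← prob_transpose]
  rfl

lemma prob_mul_transpose_eq_sum {l m n : ℕ} (Y : Matrix (Fin m) (Fin n) ℂ)
    (M : Matrix (Fin l) (Fin n) ℂ) : prob (Y * Mᵀ) = ∑ i, nsq (M *ᵥ Y i) := by
  rw [prob_eq_sum_rows]
  refine Finset.sum_congr rfl fun i _ => ?_
  rw [← Matrix.vecMul_transpose]; rfl

lemma IsLocalMeasurement.sum_prob_left {k m n : ℕ} {r : Fin k → ℕ}
    {M : ∀ α, Matrix (Fin (r α)) (Fin m) ℂ} (hM : IsLocalMeasurement M)
    (Y : Matrix (Fin m) (Fin n) ℂ) : ∑ α, prob (M α * Y) = prob Y := by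
  simp only [prob_mul_eq_sum]
  rw [Finset.sum_comm, ← prob_transpose]
  exact Finset.sum_congr rfl fun j _ => hM.sum_nsq _

lemma IsLocalMeasurement.sum_prob_right {k m n : ℕ} {r : Fin k → ℕ}
    {M : ∀ α, Matrix (Fin (r α)) (Fin n) ℂ} (hM : IsLocalMeasurement M)
    (Y : Matrix (Fin m) (Fin n) ℂ) : ∑ α, prob (Y * (M α)ᵀ) = prob Y := by
  simp only [prob_mul_transpose_eq_sum]
  rw [Finset.sum_comm]
  exact Finset.sum_congr rfl fun i _ => hM.sum_nsq _

lemma nsq_normalized_mulVec {m n : ℕ} (Y : Matrix (Fin m) (Fin n) ℂ) (v : Fin n → ℂ) :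
    nsq (normalized Y *ᵥ v) = (prob Y)⁻¹ * nsq (Y *ᵥ v) := by
  rw [normalized, Matrix.smul_mulVec, nsq_smul, normSq_inv_sqrt (prob_nonneg Y)]

lemma nsq_vecMul_normalized {m n : ℕ} (Y : Matrix (Fin m) (Fin n) ℂ) (v : Fin m → ℂ) :
    nsq (v ᵥ* normalized Y) = (prob Y)⁻¹ * nsq (v ᵥ* Y) := by
  rw [normalized, Matrix.vecMul_smul, nsq_smul, normSq_inv_sqrt (prob_nonneg Y)]

/-- The leading right singular vector `v` of `Y` remains a test vector for every `M α * Y`, and `∑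
|M_α Y v|² = |Y v|² = top Y`. So the average of `top` over the outcomes is at least `top Y`. Signs
are reversed to fit `exists_le_of_weighted_sum_le`. -/
lemma IsLocalMeasurement.exists_top_le_left {k m n : ℕ} {r : Fin k → ℕ}
    {M : ∀ α, Matrix (Fin (r α)) (Fin m) ℂ} (hM : IsLocalMeasurement M)
    {Y : Matrix (Fin m) (Fin n) ℂ} (hY : prob Y = 1) :
    ∃ α, 0 < prob (M α * Y) ∧ top Y ≤ top (normalized (M α * Y)) := by
  obtain ⟨g, v, σ, hσ, hg, hv, hYv, -, ht⟩ := exists_singular_pair (Y := Y) (by rw [hY]; norm_num)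
  have htop : nsq (Y *ᵥ v) = top Y := by
    rw [hYv, nsq_smul, hg, ← ht]; simp
  have key : ∑ α, prob (M α * Y) * (- top (normalized (M α * Y))) ≤ - top Y := by
    rw [← htop, ← hM.sum_nsq (Y *ᵥ v), ← Finset.sum_neg_distrib]
    refine Finset.sum_le_sum fun α _ => ?_
    have h1 := nsq_mulVec_le_top_of_unit (normalized (M α * Y)) hv
    rw [nsq_normalized_mulVec] at h1
    have h2 := nsq_mulVec_le (M α * Y) v
    rw [hv, mul_one] at h2
    rw [Matrix.mulVec_mulVec, mul_neg]
    rcases (prob_nonneg (M α * Y)).eq_or_lt with h | h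
    · rw [← h] at h2 ⊢; linarith
    · rw [inv_mul_le_iff₀ h] at h1; linarith
  obtain ⟨α, h1, h2⟩ := exists_le_of_weighted_sum_le (fun α => prob_nonneg _)
    ((hM.sum_prob_left Y).trans hY) key
  exact ⟨α, h1, by linarith⟩

lemma IsLocalMeasurement.exists_top_le_right {k m n : ℕ} {r : Fin k → ℕ}
    {M : ∀ α, Matrix (Fin (r α)) (Fin n) ℂ} (hM : IsLocalMeasurement M)
    {Y : Matrix (Fin m) (Fin n) ℂ} (hY : prob Y = 1) :
    ∃ α, 0 < prob (Y * (M α)ᵀ) ∧ top Y ≤ top (normalized (Y * (M α)ᵀ)) := by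
  obtain ⟨g, v, σ, hσ, hg, hv, -, hYg, ht⟩ := exists_singular_pair (Y := Y) (by rw [hY]; norm_num)
  have htop : nsq (star g ᵥ* Y) = top Y := by
    rw [star_vecMul_eq, nsq_star, hYg, nsq_smul, hv, ← ht]; simp
  have key : ∑ α, prob (Y * (M α)ᵀ) * (- top (normalized (Y * (M α)ᵀ))) ≤ - top Y := by
    rw [← htop, ← hM.sum_nsq (star g ᵥ* Y), ← Finset.sum_neg_distrib]
    refine Finset.sum_le_sum fun α _ => ?_
    have h1 := nsq_vecMul_le_top (normalized (Y * (M α)ᵀ)) hg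
    rw [nsq_vecMul_normalized] at h1
    have h2 := nsq_vecMul_le (Y * (M α)ᵀ) g
    rw [hg, one_mul] at h2
    rw [← Matrix.vecMul_transpose, Matrix.vecMul_vecMul, mul_neg]
    rcases (prob_nonneg (Y * (M α)ᵀ)).eq_or_lt with h | h
    · rw [← h] at h2 ⊢; linarith
    · rw [inv_mul_le_iff₀ h] at h1; linarith
  obtain ⟨α, h1, h2⟩ := exists_le_of_weighted_sum_le (fun α => prob_nonneg _)
    ((hM.sum_prob_right Y).trans hY) key
  exact ⟨α, h1, by linarith⟩

/-! ### Entanglement swapping -/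

/-- Parseval's identity: completeness says that the `X α`, read as vectors of the tensor product,
resolve the identity. It is applied to the product vector of `u` and `v`. -/
lemma IsSwapMeasurement.sum_normSq {k m n : ℕ} {X : Fin k → Matrix (Fin m) (Fin n) ℂ}
    (hX : IsSwapMeasurement X) (u : Fin m → ℂ) (v : Fin n → ℂ) :
    ∑ α, ‖u ⬝ᵥ (X α *ᵥ v)‖ ^ 2 = nsq u * nsq v := by
  have h : ((∑ α, ‖u ⬝ᵥ (X α *ᵥ v)‖ ^ 2 : ℝ) : ℂ) = ((nsq u * nsq v : ℝ) : ℂ) := by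
    have e1 : ∀ α, u ⬝ᵥ (X α *ᵥ v) = ∑ p : Fin m × Fin n, u p.1 * v p.2 * X α p.1 p.2 := by
      intro α
      rw [Fintype.sum_prod_type]
      simp only [dotProduct, Matrix.mulVec, Finset.mul_sum]
      exact Finset.sum_congr rfl fun i _ => Finset.sum_congr rfl fun j _ => by ring
    have e2 : ∀ α, ((‖u ⬝ᵥ (X α *ᵥ v)‖ ^ 2 : ℝ) : ℂ) =
        ∑ p : Fin m × Fin n, ∑ q : Fin m × Fin n, star (u p.1 * v p.2) * (u q.1 * v q.2) *
          (star (X α p.1 p.2) * X α q.1 q.2) := by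
      intro α
      rw [Complex.ofReal_pow, ← Complex.conj_mul', e1, map_sum, Finset.sum_mul_sum]
      refine Finset.sum_congr rfl fun p _ => Finset.sum_congr rfl fun q _ => ?_
      simp only [Complex.star_def, map_mul]; ring
    rw [Complex.ofReal_sum, Finset.sum_congr rfl fun α _ => e2 α, Finset.sum_comm]
    calc _ = ∑ p : Fin m × Fin n, star (u p.1 * v p.2) * (u p.1 * v p.2) := by
          refine Finset.sum_congr rfl fun p _ => ?_
          rw [Finset.sum_comm, Finset.sum_eq_single p]
          · rw [← Finset.mul_sum, hX]; simp
          · intro q _ hq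
            rw [← Finset.mul_sum, hX, if_neg, mul_zero]
            exact fun h => hq (Prod.ext h.1.symm h.2.symm)
          · simp
      _ = _ := by
          rw [Fintype.sum_prod_type, Complex.ofReal_mul]
          simp only [nsq, Complex.ofReal_sum, Finset.sum_mul_sum, Complex.ofReal_pow,
            ← Complex.conj_mul', Complex.star_def, map_mul]
          exact Finset.sum_congr rfl fun i _ => Finset.sum_congr rfl fun j _ => by ring
  exact_mod_cast h

section

variable {m n m' n' k : ℕ} {X : Fin k → Matrix (Fin n) (Fin m') ℂ}

lemma IsSwapMeasurement.sum_corner (hX : IsSwapMeasurement X) (Ψ : Matrix (Fin m) (Fin n) ℂ)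
    (Φ : Matrix (Fin m') (Fin n') ℂ) (e : Fin m → ℂ) (f : Fin n' → ℂ) :
    ∑ α, ‖star e ⬝ᵥ ((Ψ * X α * Φ) *ᵥ f)‖ ^ 2 = nsq (star e ᵥ* Ψ) * nsq (Φ *ᵥ f) := by
  rw [← hX.sum_normSq]
  refine Finset.sum_congr rfl fun α _ => ?_
  rw [← Matrix.mulVec_mulVec, ← Matrix.mulVec_mulVec, Matrix.dotProduct_mulVec]

lemma IsSwapMeasurement.sum_left (hX : IsSwapMeasurement X) (Ψ : Matrix (Fin m) (Fin n) ℂ)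
    (Φ : Matrix (Fin m') (Fin n') ℂ) (e : Fin m → ℂ) :
    ∑ α, nsq (star e ᵥ* (Ψ * X α * Φ)) = nsq (star e ᵥ* Ψ) * prob Φ := by
  have h : ∀ α, nsq (star e ᵥ* (Ψ * X α * Φ)) =
      ∑ j, ‖(star e ᵥ* Ψ) ⬝ᵥ (X α *ᵥ Φ.col j)‖ ^ 2 := by
    intro α
    refine Finset.sum_congr rfl fun j _ => ?_
    rw [← Matrix.vecMul_vecMul, ← Matrix.vecMul_vecMul, Matrix.dotProduct_mulVec]
    rfl
  rw [Finset.sum_congr rfl fun α _ => h α, Finset.sum_comm,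
    Finset.sum_congr rfl fun j _ => hX.sum_normSq _ _, ← Finset.mul_sum, ← prob_transpose]
  rfl

lemma IsSwapMeasurement.sum_right (hX : IsSwapMeasurement X) (Ψ : Matrix (Fin m) (Fin n) ℂ)
    (Φ : Matrix (Fin m') (Fin n') ℂ) (f : Fin n' → ℂ) :
    ∑ α, nsq ((Ψ * X α * Φ) *ᵥ f) = prob Ψ * nsq (Φ *ᵥ f) := by
  have h : ∀ α, nsq ((Ψ * X α * Φ) *ᵥ f) = ∑ i, ‖Ψ.row i ⬝ᵥ (X α *ᵥ (Φ *ᵥ f))‖ ^ 2 := by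
    intro α
    refine Finset.sum_congr rfl fun i _ => ?_
    rw [← Matrix.mulVec_mulVec, ← Matrix.mulVec_mulVec]
    rfl
  rw [Finset.sum_congr rfl fun α _ => h α, Finset.sum_comm,
    Finset.sum_congr rfl fun i _ => hX.sum_normSq _ _, ← Finset.sum_mul]
  rfl

lemma IsSwapMeasurement.sum_prob (hX : IsSwapMeasurement X) (Ψ : Matrix (Fin m) (Fin n) ℂ)
    (Φ : Matrix (Fin m') (Fin n') ℂ) : ∑ α, prob (Ψ * X α * Φ) = prob Ψ * prob Φ := by
  have h : ∀ α, prob (Ψ * X α * Φ) = ∑ j, nsq ((Ψ * X α) *ᵥ Φ.col j) := fun α =>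
    prob_mul_eq_sum _ _
  have h2 : ∀ j, ∑ α, nsq ((Ψ * X α) *ᵥ Φ.col j) = prob Ψ * nsq (Φ.col j) := by
    intro j
    simpa using hX.sum_right Ψ (1 : Matrix (Fin m') (Fin m') ℂ) (Φ.col j)
  rw [Finset.sum_congr rfl fun α _ => h α, Finset.sum_comm, Finset.sum_congr rfl fun j _ => h2 j,
    ← Finset.mul_sum, ← prob_transpose Φ]
  rfl

/-- The right-hand side is `‖S Ψ‖² ‖Φ T‖²`: a complete relay measurement factorizes every quadratic
quantity. -/
lemma IsSwapMeasurement.sum_weight (hX : IsSwapMeasurement X) {Ψ : Matrix (Fin m) (Fin n) ℂ}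
    {Φ : Matrix (Fin m') (Fin n') ℂ} (hΨ : prob Ψ = 1) (hΦ : prob Φ = 1)
    (A α B β : ℝ) (e : Fin m → ℂ) (f : Fin n' → ℂ) :
    ∑ i, weight A α B β (Ψ * X i * Φ) e f =
      (A - (A - α) * nsq (star e ᵥ* Ψ)) * (B - (B - β) * nsq (Φ *ᵥ f)) := by
  simp only [weight, Finset.sum_add_distrib, Finset.sum_sub_distrib, ← Finset.mul_sum,
    hX.sum_prob, hX.sum_left, hX.sum_right, hX.sum_corner, hΨ, hΦ]
  ring

lemma weight_smul (A α B β : ℝ) (c : ℂ) (Y : Matrix (Fin m) (Fin n) ℂ) (e : Fin m → ℂ)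
    (f : Fin n → ℂ) : weight A α B β (c • Y) e f = ‖c‖ ^ 2 * weight A α B β Y e f := by
  simp only [weight, prob_smul, Matrix.vecMul_smul, Matrix.smul_mulVec, nsq_smul, dotProduct_smul,
    smul_eq_mul, norm_mul, mul_pow]
  ring

/-- Minimizes `A(1 - a) + a/A` over `A ≥ 1`. The minimizer is `A = √(a/(1-a))` for `1/2 < a < 1` and
`A = 1` for `a ≤ 1/2`. For `a = 1` the infimum `0` is only approached as `A → ∞`, hence the error
`η`. -/
lemma exists_tilt {a η : ℝ} (ha1 : a ≤ 1) (hη : 0 < η) :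
    ∃ A α : ℝ, 0 ≤ α ∧ A * α = 1 ∧ α ≤ A ∧
      A - (A - α) * a ≤ 2 * Real.sqrt (max (1 / 2) a * (1 - max (1 / 2) a)) + η := by
  rcases le_or_gt a (1 / 2) with h | h
  · refine ⟨1, 1, zero_le_one, one_mul 1, le_rfl, ?_⟩
    rw [max_eq_left h, show (1 / 2 * (1 - 1 / 2) : ℝ) = (1 / 2) ^ 2 by norm_num,
      Real.sqrt_sq (by norm_num)]
    linarith
  · rw [max_eq_right h.le]
    have ha0 : 0 < a := by linarith
    rcases ha1.eq_or_lt with rfl | ha1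
    · have hm : 0 < min η 1 := lt_min hη one_pos
      refine ⟨(min η 1)⁻¹, min η 1, hm.le, inv_mul_cancel₀ hm.ne', ?_, ?_⟩
      · exact (min_le_right _ _).trans ((one_le_inv₀ hm).2 (min_le_right _ _))
      · simp
    · have hb : 0 < 1 - a := by linarith
      set x := Real.sqrt a
      set y := Real.sqrt (1 - a)
      have hx : 0 < x := Real.sqrt_pos.2 ha0
      have hy : 0 < y := Real.sqrt_pos.2 hb
      have hx2 : x ^ 2 = a := Real.sq_sqrt ha0.le
      have hy2 : y ^ 2 = 1 - a := Real.sq_sqrt hb.le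
      refine ⟨x / y, y / x, by positivity, by field_simp, ?_, ?_⟩
      · rw [div_le_div_iff₀ hx hy]; nlinarith
      · rw [Real.sqrt_mul ha0.le]
        change _ ≤ 2 * (x * y) + η
        have : x / y - (x / y - y / x) * a = 2 * (x * y) := by
          have h1 : x / y - (x / y - y / x) * a = x / y * (1 - a) + y / x * a := by ring
          rw [h1, ← hy2, ← hx2]; field_simp; ring
        linarith

lemma IsSwapMeasurement.exists_concurrence_le (hX : IsSwapMeasurement X)
    {Ψ : Matrix (Fin m) (Fin n) ℂ} {Φ : Matrix (Fin m') (Fin n') ℂ} (hΨ : prob Ψ = 1)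
    (hΦ : prob Φ = 1) :
    ∃ α, 0 < prob (Ψ * X α * Φ) ∧
      2 * Real.sqrt (head (normalized (Ψ * X α * Φ)) * (1 - head (normalized (Ψ * X α * Φ)))) ≤
        (2 * Real.sqrt (max (1 / 2) (top Ψ) * (1 - max (1 / 2) (top Ψ)))) *
          (2 * Real.sqrt (max (1 / 2) (top Φ) * (1 - max (1 / 2) (top Φ)))) := by
  obtain ⟨e, v, σ, hσ, he, hv, -, hYg, ht⟩ := exists_singular_pair (Y := Ψ) (by rw [hΨ]; norm_num)
  have htΨ : nsq (star e ᵥ* Ψ) = top Ψ := by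
    rw [star_vecMul_eq, nsq_star, hYg, nsq_smul, hv, ← ht]; simp
  obtain ⟨g, f, τ, hτ, hg, hf, hYv, -, ht'⟩ := exists_singular_pair (Y := Φ) (by rw [hΦ]; norm_num)
  have htΦ : nsq (Φ *ᵥ f) = top Φ := by
    rw [hYv, nsq_smul, hg, ← ht']; simp
  refine exists_le_of_weighted_sum_le (fun α => prob_nonneg _)
    (by rw [hX.sum_prob, hΨ, hΦ, one_mul]) ?_
  -- The bound is proved with an error `η` in each factor, and then `η → 0`.
  have htend : Filter.Tendsto (fun η : ℝ =>
      (2 * Real.sqrt (max (1 / 2) (top Ψ) * (1 - max (1 / 2) (top Ψ))) + η) *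
        (2 * Real.sqrt (max (1 / 2) (top Φ) * (1 - max (1 / 2) (top Φ))) + η))
      (nhdsWithin 0 (Set.Ioi 0)) (nhds
      ((2 * Real.sqrt (max (1 / 2) (top Ψ) * (1 - max (1 / 2) (top Ψ))) + 0) *
        (2 * Real.sqrt (max (1 / 2) (top Φ) * (1 - max (1 / 2) (top Φ))) + 0))) := by
    refine Filter.Tendsto.mono_left ?_ nhdsWithin_le_nhds
    exact (Continuous.tendsto (by fun_prop) 0)
  rw [add_zero, add_zero] at htend
  refine ge_of_tendsto htend ?_
  filter_upwards [self_mem_nhdsWithin] with η hη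
  have hη : 0 < η := hη
  obtain ⟨A, α, hα, hA, hαA, h1⟩ := exists_tilt ((top_le_prob Ψ).trans_eq hΨ) hη
  obtain ⟨B, β, hβ, hB, hβB, h2⟩ := exists_tilt ((top_le_prob Φ).trans_eq hΦ) hη
  have hΦ1 := (top_le_prob Φ).trans_eq hΦ
  have hB0 : 0 ≤ B - (B - β) * top Φ := by
    nlinarith [mul_le_mul_of_nonneg_left hΦ1 (sub_nonneg.2 hβB)]
  calc _ ≤ ∑ i, weight A α B β (Ψ * X i * Φ) e f := by
        refine Finset.sum_le_sum fun i _ => ?_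
        -- An outcome of probability zero contributes nothing on the left and a nonnegative weight
        -- on the right.
        rcases (prob_nonneg (Ψ * X i * Φ)).eq_or_lt with h | h
        · rw [← h, zero_mul]
          have h3 := nsq_vecMul_le (Ψ * X i * Φ) e
          have h4 := nsq_mulVec_le (Ψ * X i * Φ) f
          rw [← h] at h3 h4
          have h5 : 0 ≤ (A - α) * (B - β) * ‖star e ⬝ᵥ ((Ψ * X i * Φ) *ᵥ f)‖ ^ 2 :=
            mul_nonneg (mul_nonneg (sub_nonneg.2 hαA) (sub_nonneg.2 hβB)) (sq_nonneg _)
          rw [weight, ← h, le_antisymm (h3.trans_eq (by simp)) (nsq_nonneg _),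
            le_antisymm (h4.trans_eq (by simp)) (nsq_nonneg _)]
          linarith
        · have hp1 := prob_normalized h
          have := concurrence_le_weight hα hβ hA hB hαA hβB (Y := normalized (Ψ * X i * Φ))
            (by rw [hp1]; norm_num) he hf
          rw [hp1] at this
          refine (mul_le_mul_of_nonneg_left this h.le).trans_eq ?_
          rw [normalized, weight_smul, normSq_inv_sqrt h.le, ← mul_assoc, mul_inv_cancel₀ h.ne',
            one_mul]
    _ = (A - (A - α) * top Ψ) * (B - (B - β) * top Φ) := by
        rw [hX.sum_weight hΨ hΦ, htΨ, htΦ]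
    _ ≤ _ := mul_le_mul h1 h2 hB0 (by positivity)

end


/-! ### The largest Schmidt numbers of networks -/

/-- The larger Schmidt number of the two-qubit state obtained by swapping two-qubit states with
larger Schmidt numbers `a` and `b`. -/
def ser (a b : ℝ) : ℝ := (1 + Real.sqrt (1 - 16 * (a * (1 - a)) * (b * (1 - b)))) / 2

/-- The larger Schmidt number obtained by purifying two parallel links. -/
def par (a b : ℝ) : ℝ := max (1 / 2) (a * b)

lemma mul_one_sub_mem {a : ℝ} (ha : a ∈ Set.Icc (1 / 2 : ℝ) 1) :
    0 ≤ a * (1 - a) ∧ a * (1 - a) ≤ 1 / 4 :=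
  ⟨mul_nonneg (by linarith [ha.1]) (by linarith [ha.2]), by nlinarith [sq_nonneg (a - 1 / 2)]⟩

lemma ser_radicand_mem {a b : ℝ} (ha : a ∈ Set.Icc (1 / 2 : ℝ) 1)
    (hb : b ∈ Set.Icc (1 / 2 : ℝ) 1) :
    0 ≤ 1 - 16 * (a * (1 - a)) * (b * (1 - b)) ∧ 1 - 16 * (a * (1 - a)) * (b * (1 - b)) ≤ 1 := by
  obtain ⟨h1, h2⟩ := mul_one_sub_mem ha
  obtain ⟨h3, h4⟩ := mul_one_sub_mem hb
  have := mul_le_mul h2 h4 h3 (by norm_num)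
  have := mul_nonneg h1 h3
  constructor <;> linarith

lemma ser_mem {a b : ℝ} (ha : a ∈ Set.Icc (1 / 2 : ℝ) 1) (hb : b ∈ Set.Icc (1 / 2 : ℝ) 1) :
    ser a b ∈ Set.Icc (1 / 2 : ℝ) 1 := by
  have h1 := Real.sqrt_nonneg (1 - 16 * (a * (1 - a)) * (b * (1 - b)))
  have h2 : Real.sqrt (1 - 16 * (a * (1 - a)) * (b * (1 - b))) ≤ 1 :=
    Real.sqrt_le_one.2 (ser_radicand_mem ha hb).2
  constructor <;> unfold ser <;> linarith

/-- Squared concurrences `4x(1 - x)` multiply under `ser`. Associativity and monotonicity of `ser`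
follow from this. -/
lemma ser_mul_one_sub {a b : ℝ} (ha : a ∈ Set.Icc (1 / 2 : ℝ) 1)
    (hb : b ∈ Set.Icc (1 / 2 : ℝ) 1) :
    ser a b * (1 - ser a b) = 4 * (a * (1 - a)) * (b * (1 - b)) := by
  have := Real.sq_sqrt (ser_radicand_mem ha hb).1
  unfold ser
  linear_combination -this / 4

lemma ser_assoc {a b c : ℝ} (ha : a ∈ Set.Icc (1 / 2 : ℝ) 1) (hb : b ∈ Set.Icc (1 / 2 : ℝ) 1)
    (hc : c ∈ Set.Icc (1 / 2 : ℝ) 1) : ser (ser a b) c = ser a (ser b c) := by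
  rw [ser, ser_mul_one_sub ha hb, ser.eq_def a, ser_mul_one_sub hb hc]
  ring_nf

/-- The function `x ↦ x (1 - x)` is decreasing on `[1/2, 1]`. -/
lemma le_of_mul_one_sub_le {x y : ℝ} (hx : 1 / 2 ≤ x)
    (h : x * (1 - x) ≤ y * (1 - y)) : y ≤ x := by
  by_contra! hlt
  nlinarith

lemma mul_one_sub_le {x y : ℝ} (hx : 1 / 2 ≤ x) (hxy : x ≤ y) :
    y * (1 - y) ≤ x * (1 - x) := by nlinarith

lemma ser_mono {a b a' b' : ℝ} (ha : a ∈ Set.Icc (1 / 2 : ℝ) 1) (hb : b ∈ Set.Icc (1 / 2 : ℝ) 1)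
    (ha' : a' ∈ Set.Icc (1 / 2 : ℝ) 1) (hb' : b' ∈ Set.Icc (1 / 2 : ℝ) 1)
    (h1 : a ≤ a') (h2 : b ≤ b') : ser a b ≤ ser a' b' := by
  have h3 := mul_le_mul (mul_one_sub_le ha.1 h1) (mul_one_sub_le hb.1 h2) (mul_one_sub_mem hb').1
    (mul_one_sub_mem ha).1
  apply le_of_mul_one_sub_le (ser_mem ha' hb').1
  rw [ser_mul_one_sub ha hb, ser_mul_one_sub ha' hb']
  linarith

lemma par_mem {a b : ℝ} (ha : a ∈ Set.Icc (1 / 2 : ℝ) 1) (hb : b ∈ Set.Icc (1 / 2 : ℝ) 1) :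
    par a b ∈ Set.Icc (1 / 2 : ℝ) 1 :=
  ⟨le_max_left _ _, max_le (by norm_num) (by nlinarith [ha.1, ha.2, hb.1, hb.2])⟩

lemma par_mono {a b a' b' : ℝ} (hb : 0 ≤ b) (ha' : 0 ≤ a') (h1 : a ≤ a') (h2 : b ≤ b') :
    par a b ≤ par a' b' :=
  max_le_max le_rfl (mul_le_mul h1 h2 hb ha')

/-- An inner truncation at `1/2` is absorbed by the outer one, since `c/2 ≤ 1/2`. Successive
purifications therefore amount to a single one. -/
lemma max_max_half_mul {x c : ℝ} (h0 : 0 ≤ c) (hc : c ≤ 1) :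
    max (1 / 2) (max (1 / 2) x * c) = max (1 / 2) (x * c) := by
  rw [max_mul_of_nonneg _ _ h0, ← max_assoc, max_eq_left (by linarith : 1 / 2 * c ≤ 1 / 2)]

lemma par_assoc {a b c : ℝ} (ha : a ∈ Set.Icc (1 / 2 : ℝ) 1)
    (hc : c ∈ Set.Icc (1 / 2 : ℝ) 1) : par (par a b) c = par a (par b c) := by
  have h1 := hc.1
  have h2 := ha.1
  rw [par, par, max_max_half_mul (by linarith) hc.2, par, par, mul_comm a (max _ _),
    max_max_half_mul (by linarith) ha.2]
  ring_nf

namespace NetState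

/-- All the links are in normalized states. -/
def Valid : NetState → Prop
  | .link Ψ => prob Ψ = 1
  | .series N₁ N₂ => N₁.Valid ∧ N₂.Valid
  | .parallel N₁ N₂ => N₁.Valid ∧ N₂.Valid

/-- The larger Schmidt number of the best two-qubit state that can be produced with certainty. -/
def value : NetState → ℝ
  | .link Ψ => max (1 / 2) (top Ψ)
  | .series N₁ N₂ => ser N₁.value N₂.value
  | .parallel N₁ N₂ => par N₁.value N₂.value

lemma Valid.value_mem : ∀ {N : NetState}, N.Valid → N.value ∈ Set.Icc (1 / 2 : ℝ) 1
  | .link Ψ, h => ⟨le_max_left _ _, max_le (by norm_num) ((top_le_prob Ψ).trans_eq h)⟩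
  | .series _ _, h => ser_mem h.1.value_mem h.2.value_mem
  | .parallel _ _, h => par_mem h.1.value_mem h.2.value_mem

lemma Same.valid_iff {N N' : NetState} (h : N.Same N') : N.Valid ↔ N'.Valid := by
  induction h with
  | refl => rfl
  | symm _ ih => exact ih.symm
  | trans _ _ ih1 ih2 => exact ih1.trans ih2
  | series_assoc => exact and_assoc
  | parallel_assoc => exact and_assoc
  | parallel_comm => exact and_comm
  | series _ _ ih1 ih2 => exact and_congr ih1 ih2
  | parallel _ _ ih1 ih2 => exact and_congr ih1 ih2

lemma Same.value_eq {N N' : NetState} (h : N.Same N') (hN : N.Valid) : N.value = N'.value := by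
  induction h with
  | refl => rfl
  | symm h ih => exact (ih (h.valid_iff.2 hN)).symm
  | trans h _ ih1 ih2 => exact (ih1 hN).trans (ih2 (h.valid_iff.1 hN))
  | series_assoc => exact ser_assoc hN.1.1.value_mem hN.1.2.value_mem hN.2.value_mem
  | parallel_assoc => exact par_assoc hN.1.1.value_mem hN.2.value_mem
  | parallel_comm => simp only [value, par, mul_comm]
  | series _ _ ih1 ih2 => simp only [value, ih1 hN.1, ih2 hN.2]
  | parallel _ _ ih1 ih2 => simp only [value, ih1 hN.1, ih2 hN.2]

end NetState

/-! ### Joining parallel links -/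

/-- The product vector. -/
def tensorVec {n n' : ℕ} (u : Fin n → ℂ) (v : Fin n' → ℂ) : Fin (n * n') → ℂ := fun i =>
  u (finProdFinEquiv.symm i).1 * v (finProdFinEquiv.symm i).2

lemma sum_finProd {n n' : ℕ} {M : Type*} [AddCommMonoid M] (f : Fin n × Fin n' → M) :
    ∑ i : Fin (n * n'), f (finProdFinEquiv.symm i) = ∑ i, ∑ j, f (i, j) := by
  rw [Equiv.sum_comp, Fintype.sum_prod_type]

lemma nsq_tensorVec {n n' : ℕ} (u : Fin n → ℂ) (v : Fin n' → ℂ) :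
    nsq (tensorVec u v) = nsq u * nsq v := by
  unfold nsq tensorVec
  rw [sum_finProd (fun p : Fin n × Fin n' => ‖u p.1 * v p.2‖ ^ 2), Finset.sum_mul_sum]
  simp [mul_pow]

lemma tensor_mulVec {m n m' n' : ℕ} (Ψ : Matrix (Fin m) (Fin n) ℂ)
    (Φ : Matrix (Fin m') (Fin n') ℂ) (u : Fin n → ℂ) (v : Fin n' → ℂ) :
    tensor Ψ Φ *ᵥ tensorVec u v = tensorVec (Ψ *ᵥ u) (Φ *ᵥ v) := by
  ext i
  simp only [Matrix.mulVec, dotProduct, tensor, tensorVec, Matrix.reindex_apply,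
    Matrix.submatrix_apply, Matrix.kroneckerMap_apply]
  rw [sum_finProd (fun p : Fin n × Fin n' => Ψ (finProdFinEquiv.symm i).1 p.1 *
    Φ (finProdFinEquiv.symm i).2 p.2 * (u p.1 * v p.2)), Finset.sum_mul_sum]
  exact Finset.sum_congr rfl fun i _ => Finset.sum_congr rfl fun j _ => by ring

lemma prob_tensor {m n m' n' : ℕ} (Ψ : Matrix (Fin m) (Fin n) ℂ)
    (Φ : Matrix (Fin m') (Fin n') ℂ) : prob (tensor Ψ Φ) = prob Ψ * prob Φ := by
  have h : ∀ i, nsq (tensor Ψ Φ i) =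
      nsq (Ψ (finProdFinEquiv.symm i).1) * nsq (Φ (finProdFinEquiv.symm i).2) := fun i =>
    nsq_tensorVec _ _
  rw [prob_eq_sum_rows, Finset.sum_congr rfl fun i _ => h i,
    sum_finProd (fun p : Fin m × Fin m' => nsq (Ψ p.1) * nsq (Φ p.2))]
  exact (Finset.sum_mul_sum Finset.univ Finset.univ
    (fun i => nsq (Ψ i)) (fun j => nsq (Φ j))).symm

lemma top_mul_top_le_top_tensor {m n m' n' : ℕ} {Ψ : Matrix (Fin m) (Fin n) ℂ}
    {Φ : Matrix (Fin m') (Fin n') ℂ} (hΨ : prob Ψ = 1) (hΦ : prob Φ = 1) :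
    top Ψ * top Φ ≤ top (tensor Ψ Φ) := by
  obtain ⟨g, v, σ, -, hg, hv, hYv, -, ht⟩ := exists_singular_pair (Y := Ψ) (by rw [hΨ]; norm_num)
  obtain ⟨g', w, τ, -, hg', hw, hYw, -, ht'⟩ := exists_singular_pair (Y := Φ) (by rw [hΦ]; norm_num)
  have := nsq_mulVec_le_top_of_unit (tensor Ψ Φ) (v := tensorVec v w)
    (by rw [nsq_tensorVec, hv, hw, one_mul])
  rw [tensor_mulVec, nsq_tensorVec, hYv, hYw, nsq_smul, nsq_smul, hg, hg'] at this
  simpa [ht, ht'] using this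

/-! ### Every operation has an outcome that does not improve the network -/

/-- The invariant behind optimality. An operation inside a larger network is covered because `ser`
and `par` are monotone in each argument. Validity is carried along so that all values stay in `[1/2,
1]`. -/
theorem Step.exists_value_le {N : NetState} {k : ℕ} {p : Fin k → ℝ} {N' : Fin k → NetState}
    (h : Step N k p N') (hN : N.Valid) :
    ∃ α, 0 < p α ∧ (N' α).Valid ∧ N.value ≤ (N' α).value := by
  induction h with
  | measureLeft Ψ M hM =>
    obtain ⟨α, h1, h2⟩ := hM.exists_top_le_left hN
    exact ⟨α, h1, prob_normalized h1, max_le_max le_rfl h2⟩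
  | measureRight Ψ M hM =>
    obtain ⟨α, h1, h2⟩ := hM.exists_top_le_right hN
    exact ⟨α, h1, prob_normalized h1, max_le_max le_rfl h2⟩
  | merge Ψ Φ =>
    have hΨ : prob Ψ = 1 := hN.1
    have hΦ : prob Φ = 1 := hN.2
    refine ⟨0, one_pos, by rw [NetState.Valid, prob_tensor, hΨ, hΦ, one_mul], ?_⟩
    have h1 := top_mul_top_le_top_tensor hΨ hΦ
    have h2 := top_le_prob Φ
    rw [hΦ] at h2
    change par (max _ _) (max _ _) ≤ max _ _
    rw [par, max_max_half_mul (by positivity) (max_le (by norm_num) h2), mul_comm]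
    refine max_le (le_max_left _ _) ?_
    rw [max_mul_of_nonneg _ _ (top_nonneg Ψ)]
    refine max_le ((?_ : _ ≤ _).trans (le_max_left _ _)) ((?_ : _ ≤ _).trans (le_max_right _ _))
    · linarith [(top_le_prob Ψ).trans_eq hΨ]
    · rwa [mul_comm]
  | swap Ψ Φ X hX =>
    have hΨ : prob Ψ = 1 := hN.1
    have hΦ : prob Φ = 1 := hN.2
    obtain ⟨α, h1, h2⟩ := hX.exists_concurrence_le hΨ hΦ
    have hp := prob_normalized h1
    refine ⟨α, h1, hp, ?_⟩
    have hv1 : NetState.Valid (.link Ψ) := hΨ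
    have hv2 : NetState.Valid (.link Φ) := hΦ
    have hv3 : NetState.Valid (.link (normalized (Ψ * X α * Φ))) := hp
    have m1 := hv1.value_mem
    have m2 := hv2.value_mem
    have m3 := hv3.value_mem
    simp only [NetState.value] at m1 m2 m3 ⊢
    rw [head, hp] at h2
    apply le_of_mul_one_sub_le m3.1
    rw [ser_mul_one_sub m1 m2]
    -- Squaring turns the inequality of concurrences into one between products `x(1 - x)`, which
    -- decrease in `x` on `[1/2, 1]`.
    have h3 := pow_le_pow_left₀ (by positivity) h2 2
    simp only [mul_pow] at h3
    rw [Real.sq_sqrt (mul_one_sub_mem m1).1, Real.sq_sqrt (mul_one_sub_mem m2).1,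
      Real.sq_sqrt (mul_one_sub_mem m3).1] at h3
    linarith
  | same h => exact ⟨0, one_pos, h.valid_iff.1 hN, (h.value_eq hN).le⟩
  | seriesLeft L h ih =>
    obtain ⟨α, h1, h2, h3⟩ := ih hN.1
    exact ⟨α, h1, ⟨h2, hN.2⟩, ser_mono hN.1.value_mem hN.2.value_mem h2.value_mem
      hN.2.value_mem h3 le_rfl⟩
  | seriesRight L h ih =>
    obtain ⟨α, h1, h2, h3⟩ := ih hN.2
    exact ⟨α, h1, ⟨hN.1, h2⟩, ser_mono hN.1.value_mem hN.2.value_mem hN.1.value_mem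
      h2.value_mem le_rfl h3⟩
  | parallelLeft L h ih =>
    obtain ⟨α, h1, h2, h3⟩ := ih hN.1
    exact ⟨α, h1, ⟨h2, hN.2⟩, par_mono (by linarith [hN.2.value_mem.1])
      (by linarith [h2.value_mem.1]) h3 le_rfl⟩
  | parallelRight L h ih =>
    obtain ⟨α, h1, h2, h3⟩ := ih hN.2
    exact ⟨α, h1, ⟨hN.1, h2⟩, par_mono (by linarith [hN.2.value_mem.1])
      (by linarith [hN.1.value_mem.1]) le_rfl h3⟩

theorem Scheme.exists_outcome_value_le {d : ℕ} {N : NetState} (s : Scheme d N) (hN : N.Valid) :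
    ∃ Ψ ∈ s.outcomes, prob Ψ = 1 ∧ N.value ≤ NetState.value (.link Ψ) := by
  induction s with
  | done Ψ => exact ⟨Ψ, rfl, hN, le_rfl⟩
  | step h next ih =>
    obtain ⟨α, h1, h2, h3⟩ := h.exists_value_le hN
    obtain ⟨Ψ, h4, h5, h6⟩ := ih α h1 h2
    exact ⟨Ψ, Set.mem_iUnion₂.2 ⟨α, h1, h4⟩, h5, h3.trans h6⟩


/-! ### Two-level states -/

lemma prob_fin_two (Y : Matrix (Fin 2) (Fin 2) ℂ) :
    prob Y = ‖Y 0 0‖ ^ 2 + ‖Y 0 1‖ ^ 2 + (‖Y 1 0‖ ^ 2 + ‖Y 1 1‖ ^ 2) := by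
  simp [prob, Fin.sum_univ_two]

lemma trace_gram (Y : Matrix (Fin 2) (Fin 2) ℂ) : (Yᴴ * Y).trace = (prob Y : ℂ) :=
  (prob_eq_trace Y).symm

lemma det_gram (Y : Matrix (Fin 2) (Fin 2) ℂ) : (Yᴴ * Y).det = ((‖Y.det‖ ^ 2 : ℝ) : ℂ) := by
  rw [Matrix.det_mul, Matrix.det_conjTranspose, Complex.star_def, Complex.conj_mul',
    Complex.ofReal_pow]

/-- `top Y` is an eigenvalue of `Yᴴ * Y`, hence a root of its characteristic polynomial `t² - (prob
Y) t + |det Y|²`. -/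
lemma top_mul_prob_sub_top {Y : Matrix (Fin 2) (Fin 2) ℂ} (h : 0 < prob Y) :
    top Y * (prob Y - top Y) = ‖Y.det‖ ^ 2 := by
  obtain ⟨g, v, σ, hσ, hg, hv, hYv, hYg, ht⟩ := exists_singular_pair h
  have hv0 : v ≠ 0 := by rintro rfl; simp [nsq] at hv
  have hdet : (Yᴴ * Y - (top Y : ℂ) • (1 : Matrix (Fin 2) (Fin 2) ℂ)).det = 0 := by
    rw [← Matrix.exists_mulVec_eq_zero_iff]
    refine ⟨v, hv0, ?_⟩
    rw [Matrix.sub_mulVec, ← Matrix.mulVec_mulVec, hYv, Matrix.mulVec_smul, hYg, smul_smul,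
      Matrix.smul_mulVec, Matrix.one_mulVec, ← ht, sub_eq_zero]
    push_cast
    rw [pow_two]
  have h1 := trace_gram Y
  have h2 := det_gram Y
  rw [Matrix.trace_fin_two] at h1
  rw [Matrix.det_fin_two] at h2 hdet
  simp only [Matrix.sub_apply, Matrix.smul_apply, Matrix.one_apply_eq, smul_eq_mul, mul_one, ne_eq,
    zero_ne_one, one_ne_zero, not_false_eq_true, Matrix.one_apply_ne, mul_zero, sub_zero] at hdet
  have h3 : ((top Y * (prob Y - top Y) : ℝ) : ℂ) = ((‖Y.det‖ ^ 2 : ℝ) : ℂ) := by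
    push_cast at h2 ⊢
    linear_combination h2 - hdet - (top Y : ℂ) * h1
  exact_mod_cast h3

/-- Each of the two columns has squared norm at most `top Y`. Hence the truncation at `1/2` in
`NetState.value` is inactive for two-qubit links. -/
lemma half_prob_le_top (Y : Matrix (Fin 2) (Fin 2) ℂ) : prob Y / 2 ≤ top Y := by
  have h0 := nsq_mulVec_le_top Y (Pi.single 0 1)
  have h1 := nsq_mulVec_le_top Y (Pi.single 1 1)
  simp only [nsq, Matrix.mulVec_single_one, Matrix.col_apply, Fin.sum_univ_two, Pi.single_apply]
    at h0 h1
  rw [prob_fin_two]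
  norm_num at h0 h1
  linarith

lemma finrank_two : Module.finrank ℂ (EuclideanSpace ℂ (Fin 2)) = 2 := by simp

lemma adjoint_comp_toEuclideanLin (Y : Matrix (Fin 2) (Fin 2) ℂ) :
    LinearMap.adjoint (Matrix.toEuclideanLin Y) ∘ₗ Matrix.toEuclideanLin Y =
      Matrix.toLin (EuclideanSpace.basisFun (Fin 2) ℂ).toBasis
        (EuclideanSpace.basisFun (Fin 2) ℂ).toBasis (Yᴴ * Y) := by
  rw [← Matrix.toEuclideanLin_conjTranspose_eq_adjoint, Matrix.toEuclideanLin_eq_toLin_orthonormal,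
    ← Matrix.toLin_mul]

lemma sqSingularValues_sum (Y : Matrix (Fin 2) (Fin 2) ℂ) :
    sqSingularValues Y 0 + sqSingularValues Y 1 = prob Y := by
  have h := (Matrix.toEuclideanLin Y).isSymmetric_adjoint_comp_self.trace_eq_sum_eigenvalues
    finrank_two
  rw [Fin.sum_univ_two, ← LinearMap.sq_singularValues_fin, ← LinearMap.sq_singularValues_fin,
    adjoint_comp_toEuclideanLin, Matrix.trace_toLin_eq, trace_gram] at h
  exact Complex.ofReal_injective h.symm

lemma sqSingularValues_mul (Y : Matrix (Fin 2) (Fin 2) ℂ) :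
    sqSingularValues Y 0 * sqSingularValues Y 1 = ‖Y.det‖ ^ 2 := by
  have h := (Matrix.toEuclideanLin Y).isSymmetric_adjoint_comp_self.det_eq_prod_eigenvalues
    finrank_two
  rw [Fin.prod_univ_two, ← LinearMap.sq_singularValues_fin, ← LinearMap.sq_singularValues_fin,
    adjoint_comp_toEuclideanLin, LinearMap.det_toLin, det_gram] at h
  exact Complex.ofReal_injective (by rw [Complex.ofReal_mul]; exact h.symm)

lemma sqSingularValues_nonneg {d : ℕ} (Y : Matrix (Fin d) (Fin d) ℂ) (i : Fin d) :
    0 ≤ sqSingularValues Y i := sq_nonneg _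

lemma sqSingularValues_anti (Y : Matrix (Fin 2) (Fin 2) ℂ) :
    sqSingularValues Y 1 ≤ sqSingularValues Y 0 :=
  pow_le_pow_left₀ (LinearMap.singularValues_nonneg _ _)
    (LinearMap.singularValues_antitone _ (by simp)) 2

lemma eq_of_mul_one_sub_eq {x y : ℝ} (hx : 1 / 2 ≤ x) (hy : 1 / 2 ≤ y)
    (h : x * (1 - x) = y * (1 - y)) : x = y :=
  le_antisymm (le_of_mul_one_sub_le hy h.ge) (le_of_mul_one_sub_le hx h.le)

/-- Trace and determinant of `Yᴴ * Y` determine both Schmidt numbers; below, two-qubit states are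
compared through the norm and `|det|` alone. -/
lemma sqSingularValues_eq {Y : Matrix (Fin 2) (Fin 2) ℂ} (h : prob Y = 1) {μ : ℝ}
    (hμ : 1 / 2 ≤ μ) (hd : ‖Y.det‖ ^ 2 = μ * (1 - μ)) :
    sqSingularValues Y = ![μ, 1 - μ] := by
  have h1 := sqSingularValues_sum Y
  have h2 := sqSingularValues_mul Y
  have h3 := sqSingularValues_anti Y
  rw [h] at h1
  have h4 : sqSingularValues Y 0 = μ := by
    apply eq_of_mul_one_sub_eq (by linarith) hμ
    rw [← hd, ← h2, ← h1]; ring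
  ext i
  fin_cases i
  · exact h4
  · simp; linarith

lemma value_link_of_det {Y : Matrix (Fin 2) (Fin 2) ℂ} (h : prob Y = 1) {μ : ℝ}
    (hμ : 1 / 2 ≤ μ) (hd : ‖Y.det‖ ^ 2 = μ * (1 - μ)) : NetState.value (.link Y) = μ := by
  have h1 := top_mul_prob_sub_top (Y := Y) (by rw [h]; norm_num)
  have h2 := half_prob_le_top Y
  rw [h] at h1 h2
  rw [NetState.value, max_eq_right h2]
  exact eq_of_mul_one_sub_eq h2 hμ (h1.trans hd)

lemma det_of_value_link {Y : Matrix (Fin 2) (Fin 2) ℂ} (h : prob Y = 1) :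
    ‖Y.det‖ ^ 2 = NetState.value (.link Y) * (1 - NetState.value (.link Y)) := by
  have h1 := top_mul_prob_sub_top (Y := Y) (by rw [h]; norm_num)
  have h2 := half_prob_le_top Y
  rw [h] at h1 h2
  rw [NetState.value, max_eq_right h2, h1]

lemma elemSymm_two (x : Fin 2 → ℝ) : elemSymm 2 x = x 0 * x 1 := by
  have h : Finset.powersetCard 2 (Finset.univ : Finset (Fin 2)) = {Finset.univ} :=
    Finset.powersetCard_self (Finset.univ : Finset (Fin 2))
  rw [elemSymm, Finset.esymm_map_val, h, Finset.sum_singleton, Fin.prod_univ_two]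

lemma gConcurrence_two (x : Fin 2 → ℝ) :
    gConcurrence x = (4 * (x 0 * x 1)) ^ ((1 : ℝ) / 2) := by
  rw [gConcurrence, kConcurrence, elemSymm_two, elemSymm_two]
  norm_num
  congr 1
  ring

/-! ### Decreasing rearrangements -/

section Sorted

variable {ι : Type*} [Fintype ι] (x : ι → ℝ)

lemma exists_sorted_list : ∃ L : List ℝ, (L : Multiset ℝ) = Finset.univ.val.map x ∧
    L.Pairwise (· ≥ ·) ∧ ∀ l, sorted x l = L.getD l 0 :=
  ⟨_, Multiset.sort_eq _ _, Multiset.pairwise_sort _ _, fun _ => rfl⟩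

lemma sorted_zero_eq {M : ℝ} (h1 : ∀ i, x i ≤ M) (h2 : ∃ i, x i = M) : sorted x 0 = M := by
  obtain ⟨L, hL, hs, h⟩ := exists_sorted_list x
  have hmem : ∀ a, a ∈ L ↔ ∃ i, x i = a := fun a => by
    rw [← Multiset.mem_coe, hL]; simp
  rw [h]
  rcases L with _ | ⟨a, L⟩
  · exact absurd ((hmem M).2 h2) (by simp)
  · rw [List.getD_cons_zero]
    obtain ⟨i, hi⟩ := (hmem a).1 (by simp)
    refine le_antisymm (hi ▸ h1 i) ?_
    rcases List.mem_cons.1 ((hmem M).2 h2) with h3 | h3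
    · exact h3.le
    · exact (List.pairwise_cons.1 hs).1 M h3

lemma sorted_one_bounds (h0 : ∀ i, 0 ≤ x i) :
    0 ≤ sorted x 1 ∧ sorted x 1 ≤ sorted x 0 ∧ sorted x 0 + sorted x 1 ≤ ∑ i, x i := by
  obtain ⟨L, hL, hs, h⟩ := exists_sorted_list x
  have hsum : ∑ i, x i = L.sum := by
    rw [← Multiset.sum_coe, hL]; rfl
  have hnn : ∀ a ∈ L, 0 ≤ a := fun a ha => by
    rw [← Multiset.mem_coe, hL] at ha
    obtain ⟨i, -, rfl⟩ := Multiset.mem_map.1 ha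
    exact h0 i
  rw [h, h, hsum]
  rcases L with _ | ⟨a, _ | ⟨b, L⟩⟩
  · simp
  · simpa using hnn a (by simp)
  · have h1 := hnn b (by simp)
    have h2 := (List.pairwise_cons.1 hs).1 b (by simp)
    have h3 : 0 ≤ L.sum := List.sum_nonneg fun c hc => hnn c (by simp [hc])
    simp only [List.getD_cons_zero, List.getD_cons_succ, List.sum_cons]
    exact ⟨h1, h2, by linarith⟩

lemma desc_two (x : Fin 2 → ℝ) :
    desc x = ![max (x 0) (x 1), x 0 + x 1 - max (x 0) (x 1)] := by
  have h0 : sorted x 0 = max (x 0) (x 1) := by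
    apply sorted_zero_eq
    · intro i; fin_cases i <;> simp
    · rcases le_total (x 0) (x 1) with h | h
      · exact ⟨1, (max_eq_right h).symm⟩
      · exact ⟨0, (max_eq_left h).symm⟩
  have h1 : sorted x 0 + sorted x 1 = x 0 + x 1 := by
    obtain ⟨L, hL, hs, h⟩ := exists_sorted_list x
    have hsum : x 0 + x 1 = L.sum := by
      rw [← Multiset.sum_coe, hL, ← Fin.sum_univ_two]; rfl
    have hlen : L.length = 2 := by
      rw [← Multiset.coe_card, hL]; simp
    obtain ⟨a, b, rfl⟩ := List.length_eq_two.1 hlen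
    rw [h, h, hsum]; simp
  ext i
  fin_cases i
  · exact h0
  · change sorted x 1 = _
    simp; linarith

end Sorted

/-! ### The rules and the values of networks -/

/-- `x` is a vector of two Schmidt numbers, the larger one being `μ`. -/
structure IsTwoLevel (x : Fin 2 → ℝ) (μ : ℝ) : Prop where
  nonneg_zero : 0 ≤ x 0
  nonneg_one : 0 ≤ x 1
  sum_eq : x 0 + x 1 = 1
  max_eq : max (x 0) (x 1) = μ

namespace IsTwoLevel

variable {x y : Fin 2 → ℝ} {μ ν : ℝ}

lemma mem (h : IsTwoLevel x μ) : μ ∈ Set.Icc (1 / 2 : ℝ) 1 := by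
  rw [← h.max_eq]
  constructor
  · rcases le_total (x 0) (x 1) with h1 | h1
    · rw [max_eq_right h1]; linarith [h.sum_eq]
    · rw [max_eq_left h1]; linarith [h.sum_eq]
  · exact max_le (by linarith [h.sum_eq, h.nonneg_one]) (by linarith [h.sum_eq, h.nonneg_zero])

lemma mul_eq (h : IsTwoLevel x μ) : x 0 * x 1 = μ * (1 - μ) := by
  rw [← h.max_eq, ← h.sum_eq]
  rcases le_total (x 0) (x 1) with h1 | h1
  · rw [max_eq_right h1]; ring
  · rw [max_eq_left h1]; ring

lemma desc_eq (h : IsTwoLevel x μ) : desc x = ![μ, 1 - μ] := by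
  rw [desc_two, h.max_eq, h.sum_eq]

lemma gConcurrence_eq (h : IsTwoLevel x μ) :
    gConcurrence x = (4 * (μ * (1 - μ))) ^ ((1 : ℝ) / 2) := by
  rw [gConcurrence_two, h.mul_eq]

lemma of_sq (h0 : x 1 ≤ x 0) (h1 : 0 ≤ x 1) (hs : x 0 + x 1 = 1) (hμ : 1 / 2 ≤ μ)
    (hm : x 0 * x 1 = μ * (1 - μ)) : IsTwoLevel x μ where
  nonneg_zero := h1.trans h0
  nonneg_one := h1
  sum_eq := hs
  max_eq := by
    rw [max_eq_left h0]
    apply eq_of_mul_one_sub_eq (by linarith) hμ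
    rw [← hm, ← hs]; ring

lemma fourier_two : fourier 2 = (((Real.sqrt 2 : ℝ) : ℂ))⁻¹ • !![-1, 1; 1, 1] := by
  have h1 : Complex.exp (-(2 * Real.pi * Complex.I) / 2) = -1 := by
    rw [← Complex.exp_neg_pi_mul_I]; congr 1; ring
  have h2 : Complex.exp (-(2 * Real.pi * Complex.I * (1 + 1)) / 2) = 1 := by
    rw [Complex.exp_eq_one_iff]; exact ⟨-1, by push_cast; ring⟩
  have h3 : Complex.exp (-(2 * Real.pi * Complex.I * (1 + 1) * (1 + 1)) / 2) = 1 := by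
    rw [Complex.exp_eq_one_iff]; exact ⟨-2, by push_cast; ring⟩
  ext i j
  fin_cases i <;> fin_cases j <;> simp [fourier, h1, h2, h3]

/-- All entries of the Fourier matrix have modulus `1/√2`, which gives `prob A = 1/2`, and its
determinant has modulus one. The factor `d = 2` restores the normalization, and the determinant
gives the product rule of `ser`. -/
lemma swap (hx : IsTwoLevel x μ) (hy : IsTwoLevel y ν) : IsTwoLevel (swapFun x y) (ser μ ν) := by
  set A := sqrtDiag (desc x) * fourier 2 * sqrtDiag (desc y) with hA
  have hμ := hx.mem
  have hν := hy.mem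
  have hμ0 : 0 ≤ μ := by linarith [hμ.1]
  have hν0 : 0 ≤ ν := by linarith [hν.1]
  have hμ1 : 0 ≤ 1 - μ := by linarith [hμ.2]
  have hν1 : 0 ≤ 1 - ν := by linarith [hν.2]
  have h2 : ((Real.sqrt 2)⁻¹) ^ 2 = 1 / 2 := by
    rw [inv_pow, Real.sq_sqrt (by norm_num)]; norm_num
  have hp : prob A = 1 / 2 := by
    rw [prob_fin_two, hA, hx.desc_eq, hy.desc_eq, fourier_two]
    simp [sqrtDiag, Matrix.diagonal_mul, Matrix.mul_diagonal, mul_pow, -inv_pow,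
      abs_of_nonneg (Real.sqrt_nonneg _), Real.sq_sqrt, hμ0, hν0, hμ1, hν1, h2]
    ring
  have hd : ‖A.det‖ ^ 2 = μ * (1 - μ) * (ν * (1 - ν)) := by
    rw [hA, Matrix.det_mul, Matrix.det_mul, hx.desc_eq, hy.desc_eq, fourier_two]
    simp only [sqrtDiag, Matrix.det_diagonal, Matrix.det_smul, Matrix.det_fin_two_of,
      Fin.prod_univ_two]
    simp only [norm_mul, mul_pow, Complex.norm_real, Real.norm_eq_abs, sq_abs, Fintype.card_fin,
      norm_inv, norm_pow, Matrix.cons_val_zero, Matrix.cons_val_one,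
      Real.sq_sqrt, hμ0, hν0, hμ1, hν1]
    rw [abs_of_nonneg (Real.sqrt_nonneg 2), ← pow_mul, mul_comm 2 2, pow_mul, h2]
    norm_num
  have e : ∀ i, swapFun x y i = 2 * sqSingularValues A i := fun i => by
    simp [swapFun, hA]
  have h3 := sqSingularValues_sum A
  have h4 := sqSingularValues_mul A
  have h5 := sqSingularValues_anti A
  have h6 := sqSingularValues_nonneg A 1
  refine of_sq ?_ ?_ ?_ (ser_mem hμ hν).1 ?_
  · rw [e, e]; linarith
  · rw [e]; linarith
  · rw [e, e]; linarith
  · rw [e, e, ser_mul_one_sub hμ hν]; linarith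

end IsTwoLevel

/-- Relational induction for folds. With `Y = Unit` it becomes plain induction for a predicate on
`X`. -/
lemma foldLeft_rel {X Y : Type*} {R : X → Y → Prop} {op : X → X → X} {op' : Y → Y → Y}
    (h : ∀ a b c d, R a b → R c d → R (op a c) (op' b d)) :
    ∀ (n : ℕ) (f : Fin (n + 1) → X) (g : Fin (n + 1) → Y), (∀ i, R (f i) (g i)) →
      R (foldLeft op n f) (foldLeft op' n g)
  | 0, _, _, hfg => hfg 0
  | n + 1, _, _, hfg => h _ _ _ _ (foldLeft_rel h n _ _ fun _ => hfg _) (hfg _)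

lemma foldLeft_par : ∀ (n : ℕ) (f : Fin (n + 1) → ℝ), (∀ i, f i ∈ Set.Icc (1 / 2 : ℝ) 1) →
    foldLeft par n f = max (1 / 2) (∏ i, f i)
  | 0, f, h => by
    rw [foldLeft, Fin.prod_univ_one]
    exact (max_eq_right (h 0).1).symm
  | n + 1, f, h => by
    rw [foldLeft, foldLeft_par n _ fun i => h _, par,
      max_max_half_mul (by linarith [(h (Fin.last (n + 1))).1]) (h _).2, Fin.prod_univ_castSucc f]

lemma IsTwoLevel.purify {n : ℕ} {x : Fin (n + 1) → Fin 2 → ℝ} {μ : Fin (n + 1) → ℝ}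
    (h : ∀ i, IsTwoLevel (x i) (μ i)) :
    IsTwoLevel (purifyFun 2 fun f : Fin (n + 1) → Fin 2 => ∏ i, x i (f i))
      (foldLeft par n μ) := by
  set z : (Fin (n + 1) → Fin 2) → ℝ := fun f => ∏ i, x i (f i) with hz
  have hx0 : ∀ i j, 0 ≤ x i j := fun i j => by
    fin_cases j
    exacts [(h i).nonneg_zero, (h i).nonneg_one]
  have hle : ∀ i j, x i j ≤ μ i := fun i j => by
    rw [← (h i).max_eq]
    fin_cases j
    exacts [le_max_left _ _, le_max_right _ _]
  have hex : ∀ i, ∃ j, x i j = μ i := fun i => by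
    rw [← (h i).max_eq]
    rcases le_total (x i 0) (x i 1) with h1 | h1
    · exact ⟨1, (max_eq_right h1).symm⟩
    · exact ⟨0, (max_eq_left h1).symm⟩
  choose j hj using hex
  have hz0 : ∀ f, 0 ≤ z f := fun f => Finset.prod_nonneg fun i _ => hx0 _ _
  have hsum : ∑ f, z f = 1 := by
    rw [hz, ← Fintype.prod_sum]
    simp [Fin.sum_univ_two, (h _).sum_eq]
  have hmax : sorted z 0 = ∏ i, μ i := by
    apply sorted_zero_eq
    · exact fun f => Finset.prod_le_prod (fun i _ => hx0 _ _) fun i _ => hle _ _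
    · exact ⟨j, Finset.prod_congr rfl fun i _ => hj i⟩
  obtain ⟨h1, h2, h3⟩ := sorted_one_bounds z hz0
  have c0 : purifyFun 2 z 0 = max (∏ i, μ i) (1 / 2) := by
    simp [purifyFun, purifyRest, hsum, hmax]
  have c1 : purifyFun 2 z 1 = 1 - max (∏ i, μ i) (1 / 2) := by
    have : purifyFun 2 z 1 = max (sorted z 1) (1 - max (∏ i, μ i) (1 / 2)) := by
      simp only [purifyFun, purifyRest, hsum, hmax, Fin.val_one]
      norm_num
    rw [this]
    -- The second pass of the loop just takes the remainder: the second largest entry is at most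
    -- `1/2` and at most one minus the largest.
    apply max_eq_right
    rw [hmax] at h2 h3
    rw [le_sub_comm]
    apply max_le <;> linarith
  rw [foldLeft_par n μ fun i => (h i).mem]
  have hprod : ∏ i, μ i ≤ 1 :=
    Finset.prod_le_one (fun i _ => by linarith [(h i).mem.1]) fun i _ => (h i).mem.2
  have hm : max (∏ i, μ i) (1 / 2) ≤ 1 := max_le hprod (by norm_num)
  have hm' : 1 / 2 ≤ max (∏ i, μ i) (1 / 2) := le_max_right _ _
  refine ⟨by rw [c0]; linarith, by rw [c1]; linarith, by rw [c0, c1]; ring, ?_⟩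
  rw [c0, c1, max_comm (1 / 2)]
  exact max_eq_left (by linarith)

lemma prob_sqrtDiag {x : Fin 2 → ℝ} (h0 : 0 ≤ x 0) (h1 : 0 ≤ x 1) :
    prob (sqrtDiag x) = x 0 + x 1 := by
  rw [prob_fin_two]
  simp [sqrtDiag, Real.sq_sqrt, h0, h1]

lemma norm_det_sqrtDiag_sq {x : Fin 2 → ℝ} (h0 : 0 ≤ x 0) (h1 : 0 ≤ x 1) :
    ‖(sqrtDiag x).det‖ ^ 2 = x 0 * x 1 := by
  simp [sqrtDiag, Matrix.det_diagonal, Fin.prod_univ_two, mul_pow, Real.sq_sqrt, h0, h1]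

/-- The rules compute the value of the initial state of a network. -/
theorem SPNetwork.valid_and_rule : ∀ N : SPNetwork 2,
    N.state.Valid ∧ IsTwoLevel N.rule N.state.value
  | .link x => by
    have h0 : 0 ≤ (x : Fin 2 → ℝ) 0 := x.2.1 0
    have h1 : 0 ≤ (x : Fin 2 → ℝ) 1 := x.2.1 1
    have hs : (x : Fin 2 → ℝ) 0 + (x : Fin 2 → ℝ) 1 = 1 := by
      rw [← Fin.sum_univ_two]; exact x.2.2
    have hp : prob (sqrtDiag (x : Fin 2 → ℝ)) = 1 := (prob_sqrtDiag h0 h1).trans hs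
    have hx : IsTwoLevel (x : Fin 2 → ℝ) _ := ⟨h0, h1, hs, rfl⟩
    refine ⟨hp, ?_⟩
    rw [SPNetwork.state, value_link_of_det hp hx.mem.1
      ((norm_det_sqrtDiag_sq h0 h1).trans hx.mul_eq)]
    exact hx
  | .series n N =>
    foldLeft_rel (op := NetState.series) (op' := swapFun) (R := fun (S : NetState) x => S.Valid ∧ IsTwoLevel x S.value)
      (fun _ _ _ _ h h' => ⟨⟨h.1, h'.1⟩, h.2.swap h'.2⟩) n _ _
      fun i => (N i).valid_and_rule
  | .parallel n N => by
    have hN := fun i => (N i).valid_and_rule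
    have hv : (foldLeft NetState.parallel n fun i => (N i).state).Valid ∧
        (foldLeft NetState.parallel n fun i => (N i).state).value =
          foldLeft par n fun i => (N i).state.value :=
      foldLeft_rel (op := NetState.parallel) (op' := par) (R := fun (S : NetState) v => S.Valid ∧ S.value = v)
        (fun _ _ _ _ h h' => ⟨⟨h.1, h'.1⟩, by rw [NetState.value, h.2, h'.2]⟩) n _ _
        fun i => ⟨(hN i).1, rfl⟩
    refine ⟨hv.1, ?_⟩
    rw [SPNetwork.state, hv.2]
    exact IsTwoLevel.purify fun i => (hN i).2


/-! ### Deterministic protocols -/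

/-- There is an adaptive protocol which turns `N` into a network with the property `T`, whatever the
outcomes of the measurements are. -/
inductive Can (T : NetState → Prop) : NetState → Prop
  | done {N} (h : T N) : Can T N
  | step {N k p N'} (h : Step N k p N') (next : ∀ α : Fin k, 0 < p α → Can T (N' α)) : Can T N

namespace Can

lemma trans {T T' : NetState → Prop} {N : NetState} (h : Can T N)
    (h' : ∀ S, T S → Can T' S) : Can T' N := by
  induction h with
  | done h => exact h' _ h
  | step h _ ih => exact .step h ih

lemma seriesLeft {N S L : NetState} (h : Can (· = S) N) :
    Can (· = .series S L) (.series N L) := by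
  induction h with
  | done h => exact .done (by rw [h])
  | step h _ ih => exact .step (.seriesLeft L h) ih

lemma seriesRight {N S L : NetState} (h : Can (· = S) N) :
    Can (· = .series L S) (.series L N) := by
  induction h with
  | done h => exact .done (by rw [h])
  | step h _ ih => exact .step (.seriesRight L h) ih

lemma parallelLeft {N S L : NetState} (h : Can (· = S) N) :
    Can (· = .parallel S L) (.parallel N L) := by
  induction h with
  | done h => exact .done (by rw [h])
  | step h _ ih => exact .step (.parallelLeft L h) ih

lemma parallelRight {N S L : NetState} (h : Can (· = S) N) :
    Can (· = .parallel L S) (.parallel L N) := by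
  induction h with
  | done h => exact .done (by rw [h])
  | step h _ ih => exact .step (.parallelRight L h) ih

lemma comp {N S S' : NetState} (h : Can (· = S) N) (h' : Can (· = S') S) : Can (· = S') N :=
  h.trans fun _ hT => hT ▸ h'

lemma unitary_left {T : NetState → Prop} {m n : ℕ} {Ψ : Matrix (Fin m) (Fin n) ℂ}
    (hΨ : prob Ψ = 1) {U : Matrix (Fin m) (Fin m) ℂ} (hU : Uᴴ * U = 1)
    (h : Can T (.link (U * Ψ))) : Can T (.link Ψ) := by
  have hM : IsLocalMeasurement (k := 1) (r := fun _ => m) fun _ => U := by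
    simp [IsLocalMeasurement, hU]
  have hp : prob (U * Ψ) = 1 := by simpa using (hM.sum_prob_left Ψ).trans hΨ
  refine .step (.measureLeft Ψ _ hM) fun α _ => ?_
  rwa [normalized_of_prob_eq_one hp]

lemma unitary_right {T : NetState → Prop} {m n : ℕ} {Ψ : Matrix (Fin m) (Fin n) ℂ}
    (hΨ : prob Ψ = 1) {U : Matrix (Fin n) (Fin n) ℂ} (hU : Uᴴ * U = 1)
    (h : Can T (.link (Ψ * Uᵀ))) : Can T (.link Ψ) := by
  have hM : IsLocalMeasurement (k := 1) (r := fun _ => n) fun _ => U := by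
    simp [IsLocalMeasurement, hU]
  have hp : prob (Ψ * Uᵀ) = 1 := by simpa using (hM.sum_prob_right Ψ).trans hΨ
  refine .step (.measureRight Ψ _ hM) fun α _ => ?_
  rwa [normalized_of_prob_eq_one hp]

end Can

/-- The two-qubit state with Schmidt numbers `μ`, `1 - μ`. -/
def qubitState (μ : ℝ) : Matrix (Fin 2) (Fin 2) ℂ := sqrtDiag ![μ, 1 - μ]

lemma qubitState_eq (μ : ℝ) :
    qubitState μ = !![((Real.sqrt μ : ℝ) : ℂ), 0; 0, ((Real.sqrt (1 - μ) : ℝ) : ℂ)] := by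
  ext i j
  fin_cases i <;> fin_cases j <;> simp [qubitState, sqrtDiag]

lemma prob_qubitState {μ : ℝ} (h : μ ∈ Set.Icc (1 / 2 : ℝ) 1) : prob (qubitState μ) = 1 := by
  rw [qubitState, prob_sqrtDiag] <;> simp <;> linarith [h.1, h.2]

lemma norm_det_qubitState_sq {μ : ℝ} (h : μ ∈ Set.Icc (1 / 2 : ℝ) 1) :
    ‖(qubitState μ).det‖ ^ 2 = μ * (1 - μ) := by
  rw [qubitState, norm_det_sqrtDiag_sq] <;> simp <;> linarith [h.1, h.2]

lemma exists_phase (z : ℂ) : ∃ c : ℂ, ‖c‖ = 1 ∧ c * z = ‖z‖ := by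
  rcases eq_or_ne z 0 with rfl | hz
  · exact ⟨1, by simp, by simp⟩
  · have h : (‖z‖ : ℂ) ≠ 0 := by simpa using hz
    refine ⟨star z / ‖z‖, by simp [hz], ?_⟩
    rw [div_mul_eq_mul_div, Complex.star_def, Complex.conj_mul', pow_two, mul_div_assoc,
      div_self h, mul_one]

/-- The Schmidt decomposition of a two-qubit state. -/
lemma can_qubitState {Y : Matrix (Fin 2) (Fin 2) ℂ} (h : prob Y = 1) {μ : ℝ} (hμ : 1 / 2 ≤ μ)
    (hd : ‖Y.det‖ ^ 2 = μ * (1 - μ)) : Can (· = .link (qubitState μ)) (.link Y) := by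
  obtain ⟨g, v, σ, hσ, hg, hv, hYv, hYg, ht⟩ := exists_singular_pair (Y := Y) (by rw [h]; norm_num)
  have htop : top Y = μ := by
    have := value_link_of_det h hμ hd
    have h2 := half_prob_le_top Y
    rw [h] at h2
    rwa [NetState.value, max_eq_right h2] at this
  have hσμ : σ = Real.sqrt μ := by rw [← htop, ← ht, Real.sqrt_sq hσ.le]
  have hgc : star (g 0) * g 0 + star (g 1) * g 1 = 1 := by
    have := star_dotProduct_self g
    rw [hg] at this
    simpa [dotProduct, Fin.sum_univ_two] using this
  have hvc : star (v 0) * v 0 + star (v 1) * v 1 = 1 := by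
    have := star_dotProduct_self v
    rw [hv] at this
    simpa [dotProduct, Fin.sum_univ_two] using this
  -- `K` and `U` complete the leading singular vectors to orthonormal bases. The phase `c` makes the
  -- remaining diagonal entry of `U Y Kᵀ` real and nonnegative.
  set K : Matrix (Fin 2) (Fin 2) ℂ := !![v 0, v 1; -star (v 1), star (v 0)] with hK
  obtain ⟨c, hc, hcz⟩ := exists_phase
    (-(g 1) * (-(Y 0 0 * star (v 1)) + Y 0 1 * star (v 0))
      + g 0 * (-(Y 1 0 * star (v 1)) + Y 1 1 * star (v 0)))
  have hcc : star c * c = 1 := by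
    rw [Complex.star_def, Complex.conj_mul', hc]; simp
  set U : Matrix (Fin 2) (Fin 2) ℂ := !![star (g 0), star (g 1); -(c * g 1), c * g 0] with hU
  have hKK : Kᴴ * K = 1 := by
    rw [hK]
    ext i j
    fin_cases i <;> fin_cases j <;> simp [Matrix.mul_apply, Fin.sum_univ_two] <;>
      simp only [Complex.star_def] at hvc <;> first | linear_combination hvc | ring
  have hUU : Uᴴ * U = 1 := by
    rw [hU]
    simp only [Complex.star_def] at hgc hcc
    ext i j
    fin_cases i <;> fin_cases j <;> simp [Matrix.mul_apply, Fin.sum_univ_two]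
    · linear_combination hgc + g 1 * (starRingEnd ℂ) (g 1) * hcc
    · linear_combination - g 0 * (starRingEnd ℂ) (g 1) * hcc
    · linear_combination - g 1 * (starRingEnd ℂ) (g 0) * hcc
    · linear_combination hgc + g 0 * (starRingEnd ℂ) (g 0) * hcc
  refine Can.unitary_right h hKK ?_
  have hp1 : prob (Y * Kᵀ) = 1 := by
    have hM : IsLocalMeasurement (k := 1) (r := fun _ => 2) fun _ => K := by
      simp [IsLocalMeasurement, hKK]
    simpa using (hM.sum_prob_right Y).trans h
  refine Can.unitary_left hp1 hUU ?_
  have hp2 : prob (U * (Y * Kᵀ)) = 1 := by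
    have hM : IsLocalMeasurement (k := 1) (r := fun _ => 2) fun _ => U := by
      simp [IsLocalMeasurement, hUU]
    simpa using (hM.sum_prob_left (Y * Kᵀ)).trans hp1
  have a0 := congrFun hYv 0
  have a1 := congrFun hYv 1
  have b0 := congrArg star (congrFun hYg 0)
  have b1 := congrArg star (congrFun hYg 1)
  simp [Matrix.mulVec, dotProduct, Fin.sum_univ_two] at a0 a1 b0 b1
  simp only [Complex.star_def] at hgc hvc hcz
  have e00 : (U * (Y * Kᵀ)) 0 0 = σ := by
    simp [hU, hK, Matrix.mul_apply, Fin.sum_univ_two]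
    linear_combination (starRingEnd ℂ) (g 0) * a0 + (starRingEnd ℂ) (g 1) * a1 + σ * hgc
  have e10 : (U * (Y * Kᵀ)) 1 0 = 0 := by
    simp [hU, hK, Matrix.mul_apply, Fin.sum_univ_two]
    linear_combination - c * g 1 * a0 + c * g 0 * a1
  have e01 : (U * (Y * Kᵀ)) 0 1 = 0 := by
    simp [hU, hK, Matrix.mul_apply, Fin.sum_univ_two]
    linear_combination - (starRingEnd ℂ) (v 1) * b0 + (starRingEnd ℂ) (v 0) * b1
  obtain ⟨r, hr0, e11⟩ : ∃ r : ℝ, 0 ≤ r ∧ (U * (Y * Kᵀ)) 1 1 = r := by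
    refine ⟨_, norm_nonneg _, Eq.trans ?_ hcz⟩
    simp [hU, hK, Matrix.mul_apply, Fin.sum_univ_two]
    ring
  have hr : r = Real.sqrt (1 - μ) := by
    rw [prob_fin_two, e00, e01, e10, e11] at hp2
    simp at hp2
    rw [← Real.sqrt_sq hr0]
    congr 1
    linarith
  refine .done ?_
  congr 1
  rw [qubitState_eq]
  ext i j
  fin_cases i <;> fin_cases j
  · simpa [hσμ] using e00
  · simpa using e01
  · simpa using e10
  · simpa [hr] using e11

lemma can_normalized {Y : Matrix (Fin 2) (Fin 2) ℂ} {p μ : ℝ} (hp : 0 < p) (h : prob Y = p)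
    (hμ : 1 / 2 ≤ μ) (hd : ‖Y.det‖ ^ 2 = p ^ 2 * (μ * (1 - μ))) :
    Can (· = .link (qubitState μ)) (.link (normalized Y)) := by
  refine can_qubitState (prob_normalized (by rwa [h])) hμ ?_
  rw [normalized, Matrix.det_smul, norm_mul, mul_pow, hd, Fintype.card_fin, norm_pow, ← pow_mul,
    mul_comm 2 2, pow_mul, normSq_inv_sqrt (prob_nonneg Y), h]
  field_simp

/-! ### Swapping -/

/-- A relay measurement in a basis of maximally entangled states, unbiased to the computational
basis. -/
def bellBasis : Fin 4 → Matrix (Fin 2) (Fin 2) ℂ :=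
  ![!![1/2, 1/2; 1/2, -1/2], !![1/2, 1/2; -1/2, 1/2], !![1/2, -1/2; 1/2, 1/2],
    !![-1/2, 1/2; 1/2, 1/2]]

lemma isSwapMeasurement_bellBasis : IsSwapMeasurement bellBasis := by
  have h2 : (starRingEnd ℂ) 2 = 2 := Complex.conj_ofNat 2
  intro μ μ' ν ν'
  fin_cases μ <;> fin_cases μ' <;> fin_cases ν <;> fin_cases ν' <;>
    simp [bellBasis, Fin.sum_univ_four, h2] <;> norm_num

lemma norm_bellBasis (α : Fin 4) (i j : Fin 2) : ‖bellBasis α i j‖ ^ 2 = 1 / 4 := by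
  fin_cases α <;> fin_cases i <;> fin_cases j <;> simp [bellBasis] <;> norm_num

lemma norm_det_bellBasis (α : Fin 4) : ‖(bellBasis α).det‖ ^ 2 = 1 / 4 := by
  fin_cases α <;> simp [bellBasis, Matrix.det_fin_two] <;> norm_num

/-- All entries and determinants of the four basis matrices have modulus `1/2`. So each outcome has
probability `1/4` and the same `|det|`, hence the same Schmidt numbers. -/
lemma can_swap {a b : ℝ} (ha : a ∈ Set.Icc (1 / 2 : ℝ) 1) (hb : b ∈ Set.Icc (1 / 2 : ℝ) 1) :
    Can (· = .link (qubitState (ser a b)))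
      (.series (.link (qubitState a)) (.link (qubitState b))) := by
  refine .step (.swap _ _ _ isSwapMeasurement_bellBasis) fun α _ => ?_
  have h0 : 0 ≤ a := by linarith [ha.1]
  have h1 : 0 ≤ 1 - a := by linarith [ha.2]
  have h2 : 0 ≤ b := by linarith [hb.1]
  have h3 : 0 ≤ 1 - b := by linarith [hb.2]
  refine can_normalized (p := 1 / 4) (by norm_num) ?_ (ser_mem ha hb).1 ?_
  · rw [prob_fin_two]
    simp [qubitState, sqrtDiag, Matrix.diagonal_mul, Matrix.mul_diagonal, mul_pow, Real.sq_sqrt,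
      norm_bellBasis, h0, h1, h2, h3]
    ring
  · rw [Matrix.det_mul, Matrix.det_mul, norm_mul, norm_mul, mul_pow, mul_pow,
      norm_det_qubitState_sq ha, norm_det_qubitState_sq hb, norm_det_bellBasis,
      ser_mul_one_sub ha hb]
    ring

/-! ### Purification -/

/-- A two-qubit state can be made less entangled with certainty. -/
lemma can_degrade {a c : ℝ} (ha : a ∈ Set.Icc (1 / 2 : ℝ) 1) (hac : a ≤ c) (hc : c ≤ 1) :
    Can (· = .link (qubitState c)) (.link (qubitState a)) := by
  rcases hac.eq_or_lt with rfl | hac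
  · exact .done rfl
  have a0 : 0 < a := by linarith [ha.1]
  have a1 : 0 < 1 - a := by linarith
  have c0 : 0 < 2 * c - 1 := by linarith [ha.1]
  have c1 : 0 ≤ 1 - c := by linarith
  have c2 : 0 ≤ c := by linarith
  -- Nielsen's protocol: `(a, 1-a)` is the mixture of `(c, 1-c)` and `(1-c, c)` with weights `t`,
  -- `1-t`, and these weights are the outcome probabilities.
  obtain ⟨t, ht⟩ : ∃ t, t = (a + c - 1) / (2 * c - 1) := ⟨_, rfl⟩
  have ht0 : 0 ≤ t := by rw [ht]; exact div_nonneg (by linarith [ha.1]) c0.le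
  have ht1 : 0 ≤ 1 - t := by
    rw [ht, sub_nonneg, div_le_one c0]; linarith
  have hta : t * c + (1 - t) * (1 - c) = a := by
    have : t * (2 * c - 1) = a + c - 1 := by rw [ht, div_mul_cancel₀ _ c0.ne']
    linarith
  set M : Fin 2 → Matrix (Fin 2) (Fin 2) ℂ :=
    ![sqrtDiag ![t * c / a, t * (1 - c) / (1 - a)],
      sqrtDiag ![(1 - t) * (1 - c) / a, (1 - t) * c / (1 - a)]] with hM
  have key : ∀ x : ℝ, 0 ≤ x →
      (starRingEnd ℂ) ((Real.sqrt x : ℝ) : ℂ) * ((Real.sqrt x : ℝ) : ℂ) = (x : ℂ) := by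
    intro x hx
    rw [Complex.conj_ofReal, ← Complex.ofReal_mul, Real.mul_self_sqrt hx]
  have x1 : 0 ≤ t * c / a := by positivity
  have x2 : 0 ≤ t * (1 - c) / (1 - a) := by positivity
  have x3 : 0 ≤ (1 - t) * (1 - c) / a := by positivity
  have x4 : 0 ≤ (1 - t) * c / (1 - a) := by positivity
  have hloc : IsLocalMeasurement (r := fun _ => 2) M := by
    have s0 : t * c / a + (1 - t) * (1 - c) / a = 1 := by
      rw [← add_div, hta, div_self a0.ne']
    have s1 : t * (1 - c) / (1 - a) + (1 - t) * c / (1 - a) = 1 := by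
      rw [← add_div, div_eq_one_iff_eq a1.ne']; linarith
    rw [IsLocalMeasurement, Fin.sum_univ_two, hM]
    ext i j
    fin_cases i <;> fin_cases j
    · simp only [sqrtDiag, Matrix.diagonal_conjTranspose, Matrix.diagonal_mul_diagonal,
        Matrix.cons_val_zero, Matrix.cons_val_one, Fin.zero_eta, Matrix.add_apply,
        Matrix.diagonal_apply_eq, Pi.star_apply, Complex.star_def, Matrix.one_apply_eq]
      rw [key _ x1, key _ x3]; exact_mod_cast s0
    · simp [sqrtDiag]
    · simp [sqrtDiag]
    · simp only [sqrtDiag, Matrix.diagonal_conjTranspose, Matrix.diagonal_mul_diagonal,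
        Matrix.cons_val_zero, Matrix.cons_val_one, Fin.mk_one, Matrix.add_apply,
        Matrix.diagonal_apply_eq, Pi.star_apply, Complex.star_def, Matrix.one_apply_eq]
      rw [key _ x2, key _ x4]; exact_mod_cast s1
  have hprod : ∀ x y : ℝ, 0 ≤ x → 0 ≤ y →
      prob (sqrtDiag ![x / a, y / (1 - a)] * qubitState a) = x + y ∧
      ‖(sqrtDiag ![x / a, y / (1 - a)] * qubitState a).det‖ ^ 2 = x * y := by
    intro x y hx hy
    have y1 : 0 ≤ x / a := by positivity
    have y2 : 0 ≤ y / (1 - a) := by positivity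
    constructor
    · rw [prob_fin_two]
      simp only [qubitState, sqrtDiag, Matrix.diagonal_mul_diagonal, Matrix.diagonal_apply_eq,
        Matrix.cons_val_zero, Matrix.cons_val_one, norm_mul, mul_pow, Complex.norm_real,
        Real.norm_eq_abs, sq_abs, Real.sq_sqrt y1, Real.sq_sqrt y2, Real.sq_sqrt a0.le,
        Real.sq_sqrt a1.le, ne_eq, zero_ne_one, one_ne_zero, not_false_eq_true,
        Matrix.diagonal_apply_ne, norm_zero]
      field_simp
      ring
    · rw [Matrix.det_mul, norm_mul, mul_pow, norm_det_sqrtDiag_sq (by simpa using y1)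
        (by simpa using y2), norm_det_qubitState_sq ha]
      simp only [Matrix.cons_val_zero, Matrix.cons_val_one]
      field_simp
  have hc2 : 1 / 2 ≤ c := by linarith
  refine .step (.measureLeft _ _ hloc) (Fin.forall_fin_two.2 ⟨fun hα => ?_, fun hα => ?_⟩)
  · obtain ⟨p1, p2⟩ := hprod (t * c) (t * (1 - c)) (by positivity) (by positivity)
    change 0 < prob (sqrtDiag _ * _) at hα
    rw [p1] at hα
    exact can_normalized hα p1 hc2 (p2.trans (by ring))
  · obtain ⟨p1, p2⟩ := hprod ((1 - t) * (1 - c)) ((1 - t) * c) (by positivity) (by positivity)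
    change 0 < prob (sqrtDiag _ * _) at hα
    rw [p1] at hα
    exact can_normalized hα p1 hc2 (p2.trans (by ring))


lemma normalized_smul {m n : ℕ} {Y : Matrix (Fin m) (Fin n) ℂ} (h : prob Y = 1) {c : ℝ}
    (hc : 0 < c) : normalized ((c : ℂ) • Y) = Y := by
  rw [normalized, prob_smul, h, mul_one, Complex.norm_real, Real.norm_eq_abs, sq_abs,
    Real.sqrt_sq hc.le, smul_smul, inv_mul_cancel₀ (by exact_mod_cast hc.ne'), one_smul]

/-- A two-level state of a qubit and a larger system is turned into a two-qubit state. -/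
lemma can_compress {n : ℕ} {u v : Fin n → ℂ} (hu : nsq u = 1) (hv : nsq v = 1)
    (huv : u ⬝ᵥ star v = 0) {μ : ℝ} (hμ : μ ∈ Set.Icc (1 / 2 : ℝ) 1) :
    Can (· = .link (qubitState μ))
      (.link (Matrix.of ![((Real.sqrt μ : ℝ) : ℂ) • u, ((Real.sqrt (1 - μ) : ℝ) : ℂ) • v])) := by
  set Y : Matrix (Fin 2) (Fin n) ℂ :=
    Matrix.of ![((Real.sqrt μ : ℝ) : ℂ) • u, ((Real.sqrt (1 - μ) : ℝ) : ℂ) • v] with hY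
  set P : Matrix (Fin 2) (Fin n) ℂ := Matrix.of ![star u, star v] with hP
  have huu : u ⬝ᵥ star u = 1 := by rw [dotProduct_comm, star_dotProduct_self, hu]; simp
  have hvv : v ⬝ᵥ star v = 1 := by rw [dotProduct_comm, star_dotProduct_self, hv]; simp
  have hvu : v ⬝ᵥ star u = 0 := by
    rw [Matrix.dotProduct_star, huv, star_zero]
  have hPP : P * Pᴴ = 1 := by
    ext i j
    fin_cases i <;> fin_cases j <;>
      simp only [hP, Matrix.mul_apply, Matrix.conjTranspose_apply, Matrix.of_apply, Fin.zero_eta,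
        Fin.mk_one, Matrix.cons_val_zero, Matrix.cons_val_one, Pi.star_apply, star_star]
    · simpa [dotProduct, mul_comm] using huu
    · simpa [dotProduct, mul_comm] using hvu
    · simpa [dotProduct, mul_comm] using huv
    · simpa [dotProduct, mul_comm] using hvv
  have hYD : Y = qubitState μ * P.map star := by
    ext i j
    fin_cases i <;> simp [hY, hP, qubitState, sqrtDiag, Matrix.diagonal_mul]
  have hPstar : P.map star = (Pᴴ)ᵀ := by ext; simp
  have hPt : P.map star * Pᵀ = 1 := by
    rw [hPstar, ← Matrix.transpose_mul, hPP, Matrix.transpose_one]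
  have hYP : Y * Pᵀ = qubitState μ := by rw [hYD, Matrix.mul_assoc, hPt, Matrix.mul_one]
  set Q : Matrix (Fin n) (Fin n) ℂ := 1 - Pᴴ * P with hQ
  have hQQ : Qᴴ * Q = Q := by
    have h1 : Pᴴ * P * (Pᴴ * P) = Pᴴ * P := by
      rw [Matrix.mul_assoc, ← Matrix.mul_assoc P, hPP, Matrix.one_mul]
    rw [hQ, Matrix.conjTranspose_sub, Matrix.conjTranspose_one, Matrix.conjTranspose_mul,
      Matrix.conjTranspose_conjTranspose, Matrix.sub_mul, Matrix.one_mul, Matrix.mul_sub,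
      Matrix.mul_one, h1]
    simp
  have hYQ : Y * Qᵀ = 0 := by
    rw [hQ, Matrix.transpose_sub, Matrix.transpose_one, Matrix.transpose_mul, Matrix.mul_sub,
      ← Matrix.mul_assoc, hYP, Matrix.mul_one, ← hPstar, hYD, sub_self]
  -- The measurement is completed by the rows of the projection `Q`, each padded by a zero row.
  -- These outcomes have probability zero because `Y Qᵀ = 0`.
  have hloc : IsLocalMeasurement (k := n + 1) (r := fun _ => 2)
      (Fin.cons P fun j => Matrix.of ![Q j, 0]) := by
    rw [IsLocalMeasurement, Fin.sum_univ_succ, Fin.cons_zero]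
    simp only [Fin.cons_succ]
    have : ∑ j, (Matrix.of ![Q j, 0])ᴴ * Matrix.of ![Q j, 0] = Qᴴ * Q := by
      ext a b
      rw [Matrix.sum_apply, Matrix.mul_apply]
      refine Finset.sum_congr rfl fun j _ => ?_
      simp [Matrix.mul_apply, Fin.sum_univ_two]
    rw [this, hQQ, hQ]
    simp
  refine .step (.measureRight _ _ hloc) fun α => ?_
  refine Fin.cases (fun _ => ?_) (fun j hj => ?_) α
  · simp only [Fin.cons_zero, hYP]
    rw [normalized_of_prob_eq_one (prob_qubitState hμ)]
    exact .done rfl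
  · exfalso
    refine hj.ne' ?_
    have h0 : Y * (Matrix.of ![Q j, 0])ᵀ = 0 := by
      ext i l
      fin_cases l
      · simpa [Matrix.mul_apply] using congrFun (congrFun hYQ i) j
      · simp [Matrix.mul_apply]
    simp only [Fin.cons_succ, h0]
    simp [prob]

/-- Signs forming a Hadamard matrix. -/
def hadamardSign : Fin 4 → Fin 4 → ℂ :=
  ![![1, 1, 1, 1], ![1, 1, -1, -1], ![1, -1, 1, -1], ![1, -1, -1, 1]]

/-- Merging the last three levels of a four-level system. -/
def collapseKraus (α : Fin 4) : Matrix (Fin 2) (Fin 4) ℂ :=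
  ((1 / 2 : ℝ) : ℂ) •
    Matrix.of ![![1, 0, 0, 0], ![0, hadamardSign α 1, hadamardSign α 2, hadamardSign α 3]]

lemma isLocalMeasurement_collapseKraus :
    IsLocalMeasurement (r := fun _ => 2) collapseKraus := by
  have h2 : (starRingEnd ℂ) 2 = 2 := Complex.conj_ofNat 2
  rw [IsLocalMeasurement]
  ext i j
  fin_cases i <;> fin_cases j <;>
    simp [collapseKraus, hadamardSign, Fin.sum_univ_four, Matrix.mul_apply, Fin.sum_univ_two, h2]
      <;> norm_num

lemma norm_hadamardSign (α j : Fin 4) : ‖hadamardSign α j‖ = 1 := by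
  fin_cases α <;> fin_cases j <;> simp [hadamardSign]

/-- One party superposes its last three levels with Hadamard signs. Every outcome leaves a two-level
state with weights `x 0`, `1 - x 0`, and `can_compress` then shrinks the other party's system to a
qubit. -/
lemma can_collapse {x : Fin 4 → ℝ} (hx : ∀ i, 0 ≤ x i) (h0 : 1 / 2 ≤ x 0)
    (hs : ∑ i, x i = 1) :
    Can (· = .link (qubitState (x 0)))
      (.link (Matrix.diagonal fun i => ((Real.sqrt (x i) : ℝ) : ℂ))) := by
  rw [Fin.sum_univ_four] at hs
  have hx1 : x 0 ≤ 1 := by linarith [hx 1, hx 2, hx 3]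
  refine .step (.measureLeft _ _ isLocalMeasurement_collapseKraus) fun α _ => ?_
  set t := Real.sqrt (1 - x 0) with ht
  have ht2 : t ^ 2 = 1 - x 0 := Real.sq_sqrt (by linarith)
  obtain ⟨v, hv, hv0, hvt⟩ : ∃ v : Fin 4 → ℂ, nsq v = 1 ∧ v 0 = 0 ∧
      ∀ i, i ≠ 0 → (t : ℂ) * v i = hadamardSign α i * (Real.sqrt (x i) : ℝ) := by
    -- If `x 0 = 1` the second level is empty, and any unit vector orthogonal to the first will do.
    rcases eq_or_ne t 0 with h | h
    · have h1 : x 1 = 0 ∧ x 2 = 0 ∧ x 3 = 0 := by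
        rw [h] at ht2
        refine ⟨?_, ?_, ?_⟩ <;> linarith [hx 1, hx 2, hx 3]
      refine ⟨![0, 1, 0, 0], by simp [nsq, Fin.sum_univ_four], rfl, fun i hi => ?_⟩
      fin_cases i
      · exact absurd rfl hi
      · simp [h, h1.1]
      · simp [h, h1.2.1]
      · simp [h, h1.2.2]
    · refine ⟨fun i => if i = 0 then 0 else hadamardSign α i * (Real.sqrt (x i) : ℝ) / t, ?_,
        if_pos rfl, fun i hi => ?_⟩
      · simp only [nsq, Fin.sum_univ_four]
        simp only [if_pos, Fin.reduceEq, if_false, norm_div, norm_mul, norm_hadamardSign, one_mul,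
          Complex.norm_real, Real.norm_eq_abs, div_pow, sq_abs, Real.sq_sqrt (hx _), ht2, norm_zero]
        have : 1 - x 0 ≠ 0 := by rw [← ht2]; exact pow_ne_zero 2 h
        field_simp
        linarith
      · simp only [if_neg hi]
        have : (t : ℂ) ≠ 0 := by exact_mod_cast h
        field_simp
  have hu : nsq (Pi.single 0 1 : Fin 4 → ℂ) = 1 := by simp [nsq, Fin.sum_univ_four]
  have huv : (Pi.single 0 1 : Fin 4 → ℂ) ⬝ᵥ star v = 0 := by simp [hv0]
  have key := can_compress hu hv huv ⟨h0, hx1⟩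
  have hK : collapseKraus α * Matrix.diagonal (fun i => ((Real.sqrt (x i) : ℝ) : ℂ)) =
      ((1 / 2 : ℝ) : ℂ) • Matrix.of ![((Real.sqrt (x 0) : ℝ) : ℂ) • (Pi.single 0 1 : Fin 4 → ℂ),
        ((Real.sqrt (1 - x 0) : ℝ) : ℂ) • v] := by
    rw [collapseKraus, Matrix.smul_mul]
    congr 1
    have e1 := hvt 1 (by decide)
    have e2 := hvt 2 (by decide)
    have e3 := hvt 3 (by decide)
    ext i j
    fin_cases i <;> fin_cases j <;> simp [Matrix.mul_diagonal, hv0, ← ht, e1, e2, e3]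
  rw [hK, normalized_smul _ (by norm_num)]
  · exact key
  · rw [prob_eq_sum_rows, Fin.sum_univ_two]
    change nsq (((Real.sqrt (x 0) : ℝ) : ℂ) • (Pi.single 0 1 : Fin 4 → ℂ)) +
      nsq (((Real.sqrt (1 - x 0) : ℝ) : ℂ) • v) = 1
    rw [nsq_smul, nsq_smul, hu, hv, Complex.norm_real, Complex.norm_real, Real.norm_eq_abs,
      Real.norm_eq_abs, sq_abs, sq_abs, Real.sq_sqrt (hx 0), Real.sq_sqrt (by linarith)]
    ring

/-- Stated for network states, since the dimensions appear as `2 * 2` on one side and `4` on the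
other. -/
lemma link_tensor_qubitState {a b : ℝ} (ha : 0 ≤ a) (ha1 : a ≤ 1) :
    NetState.link (tensor (qubitState a) (qubitState b)) =
      NetState.link (Matrix.diagonal fun i => ((Real.sqrt
        ((![a * b, a * (1 - b), (1 - a) * b, (1 - a) * (1 - b)] : Fin 4 → ℝ) i) : ℝ) : ℂ)) := by
  have h : (tensor (qubitState a) (qubitState b) : Matrix (Fin 4) (Fin 4) ℂ) =
      Matrix.diagonal fun i => ((Real.sqrt
        ((![a * b, a * (1 - b), (1 - a) * b, (1 - a) * (1 - b)] : Fin 4 → ℝ) i) : ℝ) : ℂ) := by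
    have e : ∀ i j : Fin 4, (tensor (qubitState a) (qubitState b) : Matrix (Fin 4) (Fin 4) ℂ) i j =
      qubitState a (Fin.divNat (m := 2) (n := 2) i) (Fin.divNat (m := 2) (n := 2) j) *
        qubitState b (Fin.modNat (m := 2) (n := 2) i) (Fin.modNat (m := 2) (n := 2) j) :=
      fun _ _ => rfl
    have d0 : Fin.divNat (m := 2) (n := 2) (0 : Fin 4) = 0 := rfl
    have d1 : Fin.divNat (m := 2) (n := 2) (1 : Fin 4) = 0 := rfl
    have d2 : Fin.divNat (m := 2) (n := 2) (2 : Fin 4) = 1 := rfl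
    have d3 : Fin.divNat (m := 2) (n := 2) (3 : Fin 4) = 1 := rfl
    have m0 : Fin.modNat (m := 2) (n := 2) (0 : Fin 4) = 0 := rfl
    have m1 : Fin.modNat (m := 2) (n := 2) (1 : Fin 4) = 1 := rfl
    have m2 : Fin.modNat (m := 2) (n := 2) (2 : Fin 4) = 0 := rfl
    have m3 : Fin.modNat (m := 2) (n := 2) (3 : Fin 4) = 1 := rfl
    have ha' : 0 ≤ 1 - a := by linarith
    ext i j
    rw [e]
    fin_cases i <;> fin_cases j <;>
      simp [d0, d1, d2, d3, m0, m1, m2, m3, qubitState_eq, Real.sqrt_mul, ha, ha']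
  exact congrArg (NetState.link (m := 4) (n := 4)) h

lemma can_merge {a b : ℝ} (ha : a ∈ Set.Icc (1 / 2 : ℝ) 1) (hb : b ∈ Set.Icc (1 / 2 : ℝ) 1)
    (hab : 1 / 2 ≤ a * b) : Can (· = .link (qubitState (a * b)))
      (.parallel (.link (qubitState a)) (.link (qubitState b))) := by
  have h0 : 0 ≤ a := by linarith [ha.1]
  have h1 : 0 ≤ 1 - a := by linarith [ha.2]
  have h2 : 0 ≤ b := by linarith [hb.1]
  have h3 : 0 ≤ 1 - b := by linarith [hb.2]
  refine .step (.merge _ _) fun _ _ => ?_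
  rw [link_tensor_qubitState h0 ha.2]
  refine can_collapse (x := ![a * b, a * (1 - b), (1 - a) * b, (1 - a) * (1 - b)]) ?_ hab ?_
  · intro i
    fin_cases i <;> simp <;> positivity
  · simp [Fin.sum_univ_four]; ring

lemma can_parallel {a b : ℝ} (ha : a ∈ Set.Icc (1 / 2 : ℝ) 1) (hb : b ∈ Set.Icc (1 / 2 : ℝ) 1) :
    Can (· = .link (qubitState (par a b)))
      (.parallel (.link (qubitState a)) (.link (qubitState b))) := by
  rcases le_total (1 / 2) (a * b) with h | h
  · rw [par, max_eq_right h]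
    exact can_merge ha hb h
  -- The first link is degraded to `1/(2b)`, so that the product becomes exactly `1/2`.
  · have hb0 : 0 < b := by linarith [hb.1]
    have h1 : 1 / (2 * b) * b = 1 / 2 := by field_simp
    have h2 : a ≤ 1 / (2 * b) := by
      rw [le_div_iff₀ (by linarith)]; linarith
    have h3 : 1 / (2 * b) ≤ 1 := by
      rw [div_le_one (by linarith)]; linarith [hb.1]
    rw [par, max_eq_left h, ← h1]
    exact (can_degrade ha h2 h3).parallelLeft.comp
      (can_merge ⟨ha.1.trans h2, h3⟩ hb h1.ge)

/-! ### Assembly of the optimal scheme and the theorem -/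

/-- The series and parallel rules are achieved with certainty. -/
theorem SPNetwork.can_state : ∀ N : SPNetwork 2,
    Can (· = .link (qubitState N.state.value)) N.state
  | .link x => by
    have h := (SPNetwork.link x).valid_and_rule
    have hp : prob (sqrtDiag (x : Fin 2 → ℝ)) = 1 := h.1
    exact can_qubitState hp h.2.mem.1 (det_of_value_link hp)
  | .series n N =>
    (foldLeft_rel (op := NetState.series) (op' := fun _ _ => ())
      (R := fun (S : NetState) _ => S.Valid ∧ Can (· = .link (qubitState S.value)) S)
      (fun _ _ _ _ h h' => ⟨⟨h.1, h'.1⟩, (h.2.seriesLeft.comp h'.2.seriesRight).comp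
        (can_swap h.1.value_mem h'.1.value_mem)⟩) n _ (fun _ => ())
      fun i => ⟨(N i).valid_and_rule.1, (N i).can_state⟩).2
  | .parallel n N =>
    (foldLeft_rel (op := NetState.parallel) (op' := fun _ _ => ())
      (R := fun (S : NetState) _ => S.Valid ∧ Can (· = .link (qubitState S.value)) S)
      (fun _ _ _ _ h h' => ⟨⟨h.1, h'.1⟩, (h.2.parallelLeft.comp h'.2.parallelRight).comp
        (can_parallel h.1.value_mem h'.1.value_mem)⟩) n _ (fun _ => ())
      fun i => ⟨(N i).valid_and_rule.1, (N i).can_state⟩).2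

lemma Can.exists_scheme {d : ℕ} {Φ : Matrix (Fin d) (Fin d) ℂ} {N : NetState}
    (h : Can (· = .link Φ) N) : ∃ s : Scheme d N, ∀ Ψ ∈ s.outcomes, Ψ = Φ := by
  induction h with
  | done h =>
    subst h
    exact ⟨.done Φ, fun Ψ hΨ => hΨ⟩
  | step h _ ih =>
    choose s hs using ih
    refine ⟨.step h s, fun Ψ hΨ => ?_⟩
    obtain ⟨α, hα, h1⟩ := Set.mem_iUnion₂.1 hΨ
    exact hs α hα Ψ h1

end

end DET

theorem mainTheorem7 (N : DET.SPNetwork 2) :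
    (∃ s : DET.Scheme 2 N.state,
      DET.sqSingularValues '' s.outcomes = {DET.desc N.rule}) ∧
    IsGreatest {w : ℝ | ∃ s : DET.Scheme 2 N.state, s.worstCase = w}
      (DET.gConcurrence N.rule) := by
  obtain ⟨hv, hr⟩ := N.valid_and_rule
  have hμ := hv.value_mem
  set μ := N.state.value with hμ_def
  obtain ⟨s, hs⟩ := N.can_state.exists_scheme
  have hsq : DET.sqSingularValues (DET.qubitState μ) = ![μ, 1 - μ] :=
    DET.sqSingularValues_eq (DET.prob_qubitState hμ) hμ.1 (DET.norm_det_qubitState_sq hμ)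
  have himage : DET.sqSingularValues '' s.outcomes = {DET.desc N.rule} := by
    -- Only the nonemptiness of the set of outcomes is taken from the optimality argument here.
    obtain ⟨Ψ, hΨ, -⟩ := s.exists_outcome_value_le hv
    have : s.outcomes = {DET.qubitState μ} :=
      Set.eq_singleton_iff_unique_mem.2 ⟨hs Ψ hΨ ▸ hΨ, hs⟩
    rw [this, Set.image_singleton, hsq, hr.desc_eq]
  refine ⟨⟨s, himage⟩, ⟨s, ?_⟩, ?_⟩
  · rw [DET.Scheme.worstCase, ← Set.image_image DET.gConcurrence DET.sqSingularValues, himage,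
      Set.image_singleton, csInf_singleton, hr.gConcurrence_eq, hr.desc_eq, DET.gConcurrence_two]
    rfl
  · rintro _ ⟨s', rfl⟩
    obtain ⟨Ψ, hΨ, hp, hle⟩ := s'.exists_outcome_value_le hv
    -- `sInf` lies below a given element only for sets bounded below; concurrences are nonnegative.
    have hbdd : BddBelow ((fun Ψ => DET.gConcurrence (DET.sqSingularValues Ψ)) '' s'.outcomes) := by
      refine ⟨0, ?_⟩
      rintro _ ⟨Φ, -, rfl⟩
      simp only [DET.gConcurrence_two, DET.sqSingularValues_mul]
      positivity
    refine (csInf_le hbdd ⟨Ψ, hΨ, rfl⟩).trans ?_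
    have hΨv : DET.NetState.Valid (.link Ψ) := hp
    simp only [DET.gConcurrence_two, DET.sqSingularValues_mul, hr.mul_eq,
      DET.det_of_value_link hp]
    refine Real.rpow_le_rpow ?_ ?_ (by norm_num)
    · linarith [(DET.mul_one_sub_mem hΨv.value_mem).1]
    · linarith [DET.mul_one_sub_le hμ.1 hle]
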